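/- **Setting.** A gap is a sorted sequence of $n$ elements $e=(k,v)$ (with keys $k$ from a totally ordered set) that is partitioned by rank into intervals $\mathcal I_1,\dots,\mathcal I_\ell$, stored in sorted order in an array; inside an interval the elements are unordered, and each interval stores the two splitting keys that separate it from its neighbours ($\mp\infty$ at the ends). Each of the two boundaries of the gap may or may not have been created by a query. The closest query rank of an element of rank $r$ in the gap is the closest boundary created by a query (ties arbitrary). An interval is on the left (right) side if the closest query rank is to its left (right), where an interval with equally many elements of the gap on both sides counts as left. For $c>0$, the gap is *balanced within the factor $c$* if every left-side interval $\mathcal I_t$ other than the rightmost one of the left side has fewer than $c\,(|\mathcal I_t|+|\mathcal I_{t+1}|)$ elements of the gap to its left, and symmetrically on the right side. *Strict merging* with parameter $b$: after the $T$-th update (insertion, deletion, or change-key within the gap) the outermost $b\,(\nu_2(T)+1)$ adjacent pairs of intervals are checked from either end inwards, where $\nu_2(T)$ is the exponent of $2$ in $T$, and a pair is merged if the number of elements of the gap between the pair and its closest query rank is at least the number of elements in the pair. *Change-key* of an element $e=(k,v)$ in interval $\mathcal I_j$, given by a pointer, to a key $k'$ in the gap: remove $e$ from $\mathcal I_j$,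 find an interval in which $k'$ belongs by exponential search (doubling, then binary search) over the splitting keys, outward from $\mathcal I_j$, and put $(k',v)$ there. Emptied intervals stay until they are merged. Time is the number of elementary steps (inspections of intervals, comparisons, removals, insertions, merges). **Theorem (average-case change-key).** 1. There are constants $b$, $c$, $K$ such that for every gap to which the merging condition of strict merging applies nowhere, and every sequence of updates of it, each followed by strict merging with parameter $b$: the gap is balanced within the factor $c$ after every update, and strict merging takes at most $KT$ steps in total during the first $T$ updates. 2. For every $c$ there is a constant $K$ such that the following holds for every gap that is balanced within the factor $c$, and every element $e$ of it. Changing the key of $e$ to any key in the gap is performed correctly. Let $r$ be the rank of $e$ in the gap, and let $V\neq\emptyset$ be the set of ranks in the gap that are strictly closer than $r$ to the closest query rank of $e$, or this set together with $r$. If the key of $e$ is changed to a random key in the gap such that the new rank of $e$ is uniformly distributed on $V$, then the expected time of the change-key operation is at most $K$. In particular, with strict merging, a change-key operation that moves an element closer to its closest query rank within its gap, to a uniformly random valid rank, takes $O(1)$ expected time, plus $O(1)$ amortized time for strict merging. -/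

import Mathlib

namespace LazySearch

universe u v

/-- An interval of a gap: an unordered bag of elements `(key, value)`, stored with the two splitting
keys that separate it from its neighbours (`⊥` and `⊤` stand for `-∞` and `+∞`). -/
structure Interval (κ : Type u) (ν : Type v) where
  lo : WithBot κ
  hi : WithTop κ
  elems : List (κ × ν)

/-- A gap: its two boundaries, a flag for each boundary telling whether that boundary was created in
response to a query, and the array of its intervals from left to right. -/
structure Gap (κ : Type u) (ν : Type v) where
  lo : WithBot κ
  hi : WithTop κ
  queriedLeft : Bool
  queriedRight : Bool
  ivals : List (Interval κ ν)

/-- The two directions, left (smaller keys) and right (larger keys). -/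
inductive Side where
  | left
  | right

section Basic

variable {κ : Type u} {ν : Type v}

/-- The number of elements of an interval. -/
def Interval.size (I : Interval κ ν) : ℕ := I.elems.length

/-- The union of an interval `I` and its right neighbour `J`. -/
def Interval.union (I J : Interval κ ν) : Interval κ ν :=
  { lo := I.lo, hi := J.hi, elems := I.elems ++ J.elems }

/-- All elements of the gap. -/
def Gap.elems (G : Gap κ ν) : List (κ × ν) := G.ivals.flatMap Interval.elems

/-- The number of elements of the gap. -/
def Gap.size (G : Gap κ ν) : ℕ := (G.ivals.map Interval.size).sum

/-- The size of the `t`-th interval, counted from `0`. -/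
def Gap.sizeAt (G : Gap κ ν) (t : ℕ) : ℕ := (G.ivals.map Interval.size).getD t 0

/-- The number of elements of the gap left of the `t`-th interval. -/
def Gap.before (G : Gap κ ν) (t : ℕ) : ℕ := ((G.ivals.map Interval.size).take t).sum

/-- The number of elements of the gap right of the `t`-th interval. -/
def Gap.after (G : Gap κ ν) (t : ℕ) : ℕ := ((G.ivals.map Interval.size).drop (t + 1)).sum

/-- The pointer `(j, p)` (slot `p` of interval `j`) points to the element `e`. -/
def Gap.PointsTo (G : Gap κ ν) (j p : ℕ) (e : κ × ν) : Prop :=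
  ∃ I, G.ivals[j]? = some I ∧ I.elems[p]? = some e

/-- Remove the element at `(j, p)`. The interval is kept, even if it is now empty: empty intervals
are deleted lazily, by merging. -/
def Gap.removeAt (G : Gap κ ν) (j p : ℕ) : Gap κ ν :=
  { G with ivals := G.ivals.modify j fun I => { I with elems := I.elems.eraseIdx p } }

/-- Put the element `e` into interval `t`. -/
def Gap.insertAt (G : Gap κ ν) (t : ℕ) (e : κ × ν) : Gap κ ν :=
  { G with ivals := G.ivals.modify t fun I => { I with elems := e :: I.elems } }

/-! ### Sides and balance -/

/-- Interval `t` is on the left side: the closest query rank is to its left.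
An interval with equally many elements on both sides counts as left. -/
def Gap.OnLeft (G : Gap κ ν) (t : ℕ) : Prop :=
  G.queriedLeft = true ∧ (G.queriedRight = true → G.before t ≤ G.after t)

/-- Interval `t` is on the right side: the closest query rank is to its right. -/
def Gap.OnRight (G : Gap κ ν) (t : ℕ) : Prop :=
  G.queriedRight = true ∧ (G.queriedLeft = true → G.after t < G.before t)

/-- The guarantee of the merging rule, up to the factor `c`. A left-side interval `t` that is not
the rightmost one of the left side has fewer than `c * (|I_t| + |I_{t+1}|)` elements to its left,
and the same holds, reflected, on the right side. With `c = 1` this says exactly that the rule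
(merge `I_t` into `I_{t+1}` if at least `|I_t| + |I_{t+1}|` elements are left of `I_t`, and
reflected) applies nowhere. -/
def Gap.BalancedWithin (c : ℝ) (G : Gap κ ν) : Prop :=
  ∀ t, t + 1 < G.ivals.length →
    (G.OnLeft t → G.OnLeft (t + 1) →
      (G.before t : ℝ) < c * ((G.sizeAt t : ℝ) + (G.sizeAt (t + 1) : ℝ))) ∧
    (G.OnRight t → G.OnRight (t + 1) →
      (G.after (t + 1) : ℝ) < c * ((G.sizeAt t : ℝ) + (G.sizeAt (t + 1) : ℝ)))

/-! ### Strict merging -/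

/-- For two adjacent intervals with `s` elements to their left and `r` elements to their right:
the number of elements between them and their closest query rank. -/
def outside (queriedLeft queriedRight : Bool) (s r : ℕ) : ℕ :=
  match queriedLeft, queriedRight with
  | true, true => min s r
  | true, false => s
  | false, true => r
  | false, false => 0

/-- The merging condition holds for no two adjacent intervals. -/
def Gap.FullyMerged (G : Gap κ ν) : Prop :=
  ∀ t, t + 1 < G.ivals.length →
    outside G.queriedLeft G.queriedRight (G.before t) (G.after (t + 1)) <
      G.sizeAt t + G.sizeAt (t + 1)

/-- Check the first `fuel` adjacent pairs of the given array from its head inwards, and merge the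
pair whenever at least as many elements are outside of the pair as in it; `s` is the number of
elements before the head. Returns the new array and the number of steps: one for each
check and one for each merge. -/
def mergePass (join : Interval κ ν → Interval κ ν → Interval κ ν) (q q' : Bool) :
    (fuel : ℕ) → (s : ℕ) → List (Interval κ ν) → List (Interval κ ν) × ℕ
  | 0, _, L => (L, 0)
  | _ + 1, _, [] => ([], 0)
  | _ + 1, _, [I] => ([I], 0)
  | fuel + 1, s, I :: J :: L =>
    if I.size + J.size ≤ outside q q' s (L.map Interval.size).sum then
      let res := mergePass join q q' fuel s (join I J :: L)
      (res.1, res.2 + 2)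
    else
      let res := mergePass join q q' fuel (s + I.size) (J :: L)
      (I :: res.1, res.2 + 1)

/-- Check (and merge) the outermost `depth` pairs from the left end and then the outermost `depth`
pairs from the right end. -/
def Gap.mergeOuter (depth : ℕ) (G : Gap κ ν) : Gap κ ν × ℕ :=
  let a := mergePass Interval.union G.queriedLeft G.queriedRight depth 0 G.ivals
  let b := mergePass (fun I J => Interval.union J I) G.queriedRight G.queriedLeft depth 0 a.1.reverse
  ({ G with ivals := b.1.reverse }, a.2 + b.2)

/-- The number of pairs checked from either end after the `T`-th update of a gap, `T ≥ 1`. The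
outermost `b` pairs are checked every time, the next `b` ones every second time, the next `b` ones
every fourth time, and so on: the frequency decreases exponentially from the ends inwards. -/
def checkDepth (b T : ℕ) : ℕ := b * (padicValNat 2 T + 1)

end Basic

/-! ### Exponential search

In the following searches, `ok : ℕ → Bool` is the outcome of inspecting the interval at a given
distance from the start of the search, and each inspection is one step. The result is the distance
found together with the number of steps. -/

/-- Binary search for the least `d` in `(a, b]` with `ok d`, given that `ok b` holds. -/
def binarySearch (ok : ℕ → Bool) (a b : ℕ) : ℕ × ℕ :=
  if b ≤ a + 1 then (b, 0)
  else
    if ok ((a + b) / 2) then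
      let res := binarySearch ok a ((a + b) / 2)
      (res.1, res.2 + 1)
    else
      let res := binarySearch ok ((a + b) / 2) b
      (res.1, res.2 + 1)
termination_by b - a
decreasing_by all_goals omega

/-- The doubling phase: inspect distances `d, 2 d, 4 d, …` until one is `ok` or reaches the maximal
distance `m`, then binary search in the last stretch. The maximal distance needs no inspection,
because the outermost splitting key is infinite. -/
def gallop (ok : ℕ → Bool) (m d : ℕ) : ℕ × ℕ :=
  if m ≤ d ∨ d = 0 then
    let res := binarySearch ok (d / 2) m
    (res.1, res.2 + 1)
  else
    if ok d then
      let res := binarySearch ok (d / 2) d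
      (res.1, res.2 + 1)
    else
      let res := gallop ok m (2 * d)
      (res.1, res.2 + 1)
termination_by m - d
decreasing_by omega

section Ordered

variable {κ : Type u} {ν : Type v} [LinearOrder κ]

/-- The key `k` falls into the gap. -/
def Gap.InRange (G : Gap κ ν) (k : κ) : Prop := G.lo ≤ (k : WithBot κ) ∧ (k : WithTop κ) ≤ G.hi

instance (G : Gap κ ν) (k : κ) : Decidable (G.InRange k) :=
  inferInstanceAs (Decidable (G.lo ≤ (k : WithBot κ) ∧ (k : WithTop κ) ≤ G.hi))

/-- Well-formedness: there is at least one interval, the outermost splitting keys are infinite,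
adjacent intervals share a finite splitting key, the splitting keys are sorted, every interval
contains only keys between its splitting keys, and every key falls into the gap. -/
structure Gap.WellFormed (G : Gap κ ν) : Prop where
  ne_nil : G.ivals ≠ []
  head_lo : ∀ I ∈ G.ivals.head?, I.lo = ⊥
  last_hi : ∀ I ∈ G.ivals.getLast?, I.hi = ⊤
  chain : G.ivals.IsChain fun I J => ∃ k : κ, I.hi = (k : WithTop κ) ∧ J.lo = (k : WithBot κ)
  sorted : ∀ I ∈ G.ivals, ∀ a b : κ, I.lo = (a : WithBot κ) → I.hi = (b : WithTop κ) → a ≤ b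
  mem : ∀ I ∈ G.ivals, ∀ e ∈ I.elems, I.lo ≤ (e.1 : WithBot κ) ∧ (e.1 : WithTop κ) ≤ I.hi
  inRange : ∀ e ∈ G.elems, G.InRange e.1

/-- Inspect interval `t`: its left splitting key is at most `k`. -/
def Gap.loLE (G : Gap κ ν) (k : κ) (t : ℕ) : Bool :=
  match G.ivals[t]? with
  | some I => decide (I.lo ≤ (k : WithBot κ))
  | none => true

/-- Inspect interval `t`: its right splitting key is at least `k`. -/
def Gap.leHi (G : Gap κ ν) (k : κ) (t : ℕ) : Bool :=
  match G.ivals[t]? with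
  | some I => decide ((k : WithTop κ) ≤ I.hi)
  | none => true

/-- Exponential search outward from interval `j` for an interval to which the key `k` belongs.
Returns the index of that interval and the number of steps. -/
def Gap.search (G : Gap κ ν) (j : ℕ) (k : κ) : ℕ × ℕ :=
  if G.loLE k j then
    if G.leHi k j then (j, 2)
    else
      let res := gallop (fun d => G.leHi k (j + d)) (G.ivals.length - 1 - j) 1
      (j + res.1, res.2 + 2)
  else
    let res := gallop (fun d => G.loLE k (j - d)) j 1
    (j - res.1, res.2 + 1)

/-- `ChangeKey(ptr, k)` for the pointer `ptr = (j, p)`: check that `k` falls into the gap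
(two comparisons), remove the element from its interval (one step), find its new interval by
exponential search from interval `j`, and put it there with its new key (one step). Returns the new
gap and the number of steps. The result is `none` if the element has to leave the gap (or if the
pointer is invalid). -/
def Gap.changeKey (G : Gap κ ν) (j p : ℕ) (k : κ) : Option (Gap κ ν) × ℕ :=
  if G.InRange k then
    match (G.ivals[j]?).bind (fun I => I.elems[p]?) with
    | some e =>
      let res := G.search j k
      (some ((G.removeAt j p).insertAt res.1 (k, e.2)), res.2 + 4)
    | none => (none, 2)
  else (none, 2)

/-! ### Ranks and query ranks (all ranks are within the gap and start at `1`) -/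

/-- `r` is the rank in the gap of the element at `(j, p)`; ties between equal keys of the same
interval may be broken in any way. -/
def Gap.IsRank (G : Gap κ ν) (j p r : ℕ) : Prop :=
  ∃ I e, G.ivals[j]? = some I ∧ I.elems[p]? = some e ∧
    G.before j + I.elems.countP (fun x => decide (x.1 < e.1)) < r ∧
    r ≤ G.before j + I.elems.countP (fun x => decide (x.1 ≤ e.1))

/-- `k` is a key with which the element at `(j, p)` gets the rank `r` in the gap: fewer than `r`
of the other elements are smaller than `k`, and at least `r - 1` of them are at most `k`. -/
def Gap.IsNewRank (G : Gap κ ν) (j p : ℕ) (k : κ) (r : ℕ) : Prop :=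
  (G.removeAt j p).elems.countP (fun x => decide (x.1 < k)) < r ∧
    r ≤ (G.removeAt j p).elems.countP (fun x => decide (x.1 ≤ k)) + 1

/-- The closest query rank of an element of rank `r` is the boundary of the gap on the given side:
that boundary was created by a query, and if both were, then it is not farther from rank `r` than
the other one. -/
def Gap.ClosestQuery (G : Gap κ ν) (r : ℕ) : Side → Prop
  | .left => G.queriedLeft = true ∧ (G.queriedRight = true → r - 1 ≤ G.size - r)
  | .right => G.queriedRight = true ∧ (G.queriedLeft = true → G.size - r ≤ r - 1)

/-- The ranks in the gap that are strictly closer than `r` to the boundary on the given side. -/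
def Gap.closerRanks (G : Gap κ ν) (r : ℕ) : Side → Finset ℕ
  | .left => Finset.Ico 1 r
  | .right => Finset.Ioc r G.size

/-! ### Updates under strict merging -/

/-- One update of a gap between two queries. -/
inductive Gap.Update : Gap κ ν → Gap κ ν → Prop
  | insert (G : Gap κ ν) (I : Interval κ ν) (t : ℕ) (e : κ × ν)
      (hI : G.ivals[t]? = some I) (hk : G.InRange e.1)
      (hlo : I.lo ≤ (e.1 : WithBot κ)) (hhi : (e.1 : WithTop κ) ≤ I.hi) :
      Gap.Update G (G.insertAt t e)
  | delete (G : Gap κ ν) (j p : ℕ) (e : κ × ν) (he : G.PointsTo j p e) :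
      Gap.Update G (G.removeAt j p)
  | changeKey (G G' : Gap κ ν) (j p : ℕ) (k : κ)
      (h : (G.changeKey j p k).1 = some G') :
      Gap.Update G G'

/-- `StrictRun b T m G`: starting with a fully merged gap, `T` updates, each one followed by a
round of strict merging with parameter `b`, have led to the gap `G`, and the rounds of strict merging
took `m` steps altogether. -/
inductive StrictRun (b : ℕ) : ℕ → ℕ → Gap κ ν → Prop
  | start (G : Gap κ ν) (hG : G.WellFormed) (hm : G.FullyMerged) : StrictRun b 0 0 G
  | step (T m : ℕ) (G G' : Gap κ ν) (hrun : StrictRun b T m G) (hup : G.Update G') :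
      StrictRun b (T + 1) (m + (G'.mergeOuter (checkDepth b (T + 1))).2)
        (G'.mergeOuter (checkDepth b (T + 1))).1

end Ordered

end LazySearch

/-! Strict merging. For an adjacent pair let `s` be the number of elements between it and a queried
end, `a` the number of intervals there, and `z` its own size. If `s < 3 * z` for all pairs near that
end, then `4 * s < 3 * (s + z)`: the prefix sums grow by the factor 4/3 every two intervals and
double every six. With `b = 18` the pair is checked whenever `2 ^ (a / 18)` divides the round
number, so its waiting time `w` is below `2 ^ (a / 18)`, and the growth yields `4 * w ≤ s + z`. A
pair that just failed the merging condition has `s < z`, hence `s + 4 * w ≤ 2 * s + z < 3 * z`. This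
is the invariant `StrictInv`. An update raises `s` by at most 1 and lowers `3 * z` by at most 3; an
unchecked round lowers `w` by 1, which repays these 4. Merges elsewhere only enlarge a pair and
shrink its surroundings, so they do no harm (`forallPairs_mergeSizes`, `forallPairs_round`). The
cost of round `T` is proportional to `padicValNat 2 T + 1`, and these sum to less than `2 * T` by
Legendre's formula.

Change-key. Exponential search costs at most linearly in the number of intervals passed
(`gallop_spec`); this crude bound is enough. Let the element start in interval `j`, with closest
query on the left. If it moves left to rank `x`, the number of intervals passed is at most the
number of `t ≤ j` with `x ≤ before t + 1` (`reach`). Summing over distinct ranks `x` and exchanging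
the sums gives at most the sum of `before t + 1` over `t ≤ j`, which balance bounds by a constant
times `before j + 1` (`sum_le_of_growth`). Since `V` is nonempty and has at least `before j` ranks,
the average is constant. Ties and the rank `r` itself may send the element the wrong way, but only
by two intervals, since two adjacent intervals are never both empty
(`Gap.BalancedWithin.before_lt`). The right side is the mirror image. -/

namespace LazySearch

universe u v

/-! ### Merging on the level of sizes -/

/-- `Q` holds for every adjacent pair of entries of `L`. Its arguments are the number and the sum of
the entries left of the pair, the sum of the pair, and the number and the sum of the entries right
of it. -/
def ForallPairs (Q : ℕ → ℕ → ℕ → ℕ → ℕ → Prop) (L : List ℕ) : Prop :=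
  ∀ A x y B, L = A ++ x :: y :: B → Q A.length A.sum (x + y) B.length B.sum

/-- `Q` persists if a pair grows and its surroundings shrink. -/
def MergeStable (Q : ℕ → ℕ → ℕ → ℕ → ℕ → Prop) : Prop :=
  ∀ ⦃a a' s s' z z' c c' r r'⦄, a' ≤ a → s' ≤ s → z ≤ z' → c' ≤ c → r' ≤ r →
    Q a s z c r → Q a' s' z' c' r'

theorem ForallPairs.imp {Q Q' : ℕ → ℕ → ℕ → ℕ → ℕ → Prop} {L : List ℕ} (h : ForallPairs Q L)
    (hQ : ∀ a s z c r, Q a s z c r → Q' a s z c r) : ForallPairs Q' L :=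
  fun A x y B hL => hQ _ _ _ _ _ (h A x y B hL)

theorem ForallPairs.reverse {Q : ℕ → ℕ → ℕ → ℕ → ℕ → Prop} {L : List ℕ} (h : ForallPairs Q L) :
    ForallPairs (fun a s z c r => Q c r z a s) L.reverse := by
  intro A x y B hL
  have h1 : L = B.reverse ++ y :: x :: A.reverse := by
    rw [← L.reverse_reverse, hL]; simp
  simpa [add_comm] using h _ _ _ _ h1

/-- Splittings of the list suit the induction along a merging pass; indices suit prefix growth and
single-entry updates. -/
theorem forallPairs_iff_index {Q : ℕ → ℕ → ℕ → ℕ → ℕ → Prop} {L : List ℕ} :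
    ForallPairs Q L ↔ ∀ t, t + 1 < L.length →
      Q t (L.take t).sum (L.getD t 0 + L.getD (t + 1) 0) (L.length - (t + 2))
        (L.drop (t + 2)).sum := by
  constructor
  · intro h t ht
    have h1 : L = L.take t ++ L[t] :: L[t + 1] :: L.drop (t + 2) := by
      rw [← List.drop_eq_getElem_cons, ← List.drop_eq_getElem_cons, List.take_append_drop]
    have h2 := h _ _ _ _ h1
    have h3 : min t L.length = t := by omega
    rw [List.length_take, List.length_drop, h3] at h2
    rw [List.getD_eq_getElem _ _ (by omega), List.getD_eq_getElem _ _ ht]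
    exact h2
  · rintro h A x y B rfl
    have h1 := h A.length (by simp)
    have h2 : (A ++ x :: y :: B).drop (A.length + 2) = B := by
      rw [List.drop_append]; simp
    have h3 : (A ++ x :: y :: B).length - (A.length + 2) = B.length := by simp; omega
    rw [h2, h3] at h1
    simpa using h1

theorem outside_swap (q q' : Bool) (s r : ℕ) : outside q' q r s = outside q q' s r := by
  cases q <;> cases q' <;> simp [outside, min_comm]

theorem outside_mono (q q' : Bool) {s s' r r' : ℕ} (hs : s' ≤ s) (hr : r' ≤ r) :
    outside q q' s' r' ≤ outside q q' s r := by
  cases q <;> cases q' <;> simp only [outside] <;> omega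

/-- The effect of `mergePass` on the sizes of the intervals. -/
def mergeSizes (q q' : Bool) : ℕ → ℕ → List ℕ → List ℕ
  | 0, _, L => L
  | _ + 1, _, [] => []
  | _ + 1, _, [x] => [x]
  | f + 1, s, x :: y :: L =>
    if x + y ≤ outside q q' s L.sum then mergeSizes q q' f s ((x + y) :: L)
    else x :: mergeSizes q q' f (s + x) (y :: L)

theorem map_size_mergePass {κ : Type*} {ν : Type*}
    {join : Interval κ ν → Interval κ ν → Interval κ ν}
    (hj : ∀ I J, (join I J).size = I.size + J.size) (q q' : Bool) (f s : ℕ)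
    (L : List (Interval κ ν)) :
    (mergePass join q q' f s L).1.map Interval.size =
      mergeSizes q q' f s (L.map Interval.size) := by
  fun_induction mergePass join q q' f s L with
  | case1 => simp [mergeSizes]
  | case2 => simp [mergeSizes]
  | case3 => simp [mergeSizes]
  | case4 s f I J L h res ih => simpa [mergeSizes, h, hj] using ih
  | case5 s f I J L h res ih => simpa [mergeSizes, h] using ih

theorem mergePass_cost_le {κ : Type*} {ν : Type*}
    (join : Interval κ ν → Interval κ ν → Interval κ ν) (q q' : Bool) (f s : ℕ)
    (L : List (Interval κ ν)) : (mergePass join q q' f s L).2 ≤ 2 * f := by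
  fun_induction mergePass join q q' f s L with
  | case1 => simp
  | case2 => simp
  | case3 => simp
  | case4 s f I J L h res ih => simp only [res] at *; omega
  | case5 s f I J L h res ih => simp only [res] at *; omega

/-- Whatever the rest of a pass does, its first entry can only absorb mass from behind. This keeps a
failed check valid until the end of the pass. -/
theorem mergeSizes_cons (q q' : Bool) (f s y : ℕ) (L : List ℕ) :
    ∃ y' L', mergeSizes q q' f s (y :: L) = y' :: L' ∧ y ≤ y' ∧ L'.sum ≤ L.sum ∧
      L'.length ≤ L.length ∧ y' + L'.sum = y + L.sum := by
  induction f generalizing s y L with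
  | zero => exact ⟨y, L, rfl, le_rfl, le_rfl, le_rfl, rfl⟩
  | succ f ih =>
    cases L with
    | nil => exact ⟨y, [], rfl, le_rfl, le_rfl, le_rfl, rfl⟩
    | cons l L =>
      by_cases h : y + l ≤ outside q q' s L.sum
      · obtain ⟨y', L', h1, h2, h3, h4, h5⟩ := ih s (y + l) L
        refine ⟨y', L', by simpa [mergeSizes, h] using h1, ?_, ?_, ?_, ?_⟩ <;>
          (try simp) <;> omega
      · obtain ⟨y', L', h1, h2, h3, h4, h5⟩ := ih (s + y) l L
        refine ⟨y, y' :: L', by simp [mergeSizes, h, h1], ?_, ?_, ?_, ?_⟩ <;> simp <;> omega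

/-- After a pass that checks the first `f` pairs, every pair fails the merging condition or
descends from an unchecked pair. -/
theorem forallPairs_mergeSizes {q q' : Bool} {Q : ℕ → ℕ → ℕ → ℕ → ℕ → Prop} (hQ : MergeStable Q)
    (hout : ∀ a s z c r, outside q q' s r < z → Q a s z c r) (f m s : ℕ) (L : List ℕ)
    (hL : ForallPairs (fun a s' z c r => f ≤ a → Q (m + a) (s + s') z c r) L) :
    ForallPairs (fun a s' z c r => Q (m + a) (s + s') z c r) (mergeSizes q q' f s L) := by
  induction f generalizing m s L with
  | zero => exact fun A x y B h => hL A x y B h (Nat.zero_le _)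
  | succ f ih =>
    match L with
    | [] => rintro A x y B hA; simp [mergeSizes] at hA
    | [x] =>
      rintro A u v B hA
      have := congrArg List.length hA
      simp [mergeSizes] at this
      omega
    | x :: y :: L =>
      by_cases h : x + y ≤ outside q q' s L.sum
      · simp only [mergeSizes, h, if_true]
        apply ih
        intro A u v B hA hf
        cases A with
        | nil =>
          -- A merge uses up one check and one interval, so position `a` of the new list descends
          -- from position `a + 1` of the old one, and the unchecked range is preserved.
          obtain ⟨rfl, rfl⟩ : x + y = u ∧ L = v :: B := by simpa using hA
          refine hQ ?_ ?_ ?_ ?_ ?_ (hL [x] y v B rfl (by simp at hf ⊢; omega)) <;> simp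
        | cons w A =>
          obtain ⟨rfl, rfl⟩ : x + y = w ∧ L = A ++ u :: v :: B := by simpa using hA
          refine hQ ?_ ?_ ?_ ?_ ?_
            (hL (x :: y :: A) u v B rfl (by simp at hf ⊢; omega)) <;> simp
          omega
      · simp only [mergeSizes, h, if_false]
        obtain ⟨y', L', h1, h2, h3, h4, h5⟩ := mergeSizes_cons q q' f (s + x) y L
        intro A u v B hA
        cases A with
        | nil =>
          rw [h1] at hA
          obtain ⟨rfl, rfl, rfl⟩ : x = u ∧ y' = v ∧ L' = B := by simpa using hA
          apply hout
          -- The check of `x, y` failed; later merges only enlarge `y` and shrink what is behind it.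
          have := outside_mono q q' (le_refl s) h3
          simp
          omega
        | cons w A =>
          simp only [List.cons_append, List.cons.injEq] at hA
          obtain ⟨rfl, hA⟩ := hA
          have := ih (m + 1) (s + x) (y :: L) (fun A' u' v' B' hA' hf => by
            have := hL (x :: A') u' v' B' (by simp [hA']) (by simpa using hf)
            simpa [add_assoc, add_comm, add_left_comm] using this) A u v B hA
          simpa [add_assoc, add_comm, add_left_comm] using this

/-! ### Waiting times and the invariant of strict merging -/

/-- The number of rounds after round `T` in which a pair with `a` intervals outside of it may
remain unchecked by strict merging with parameter `18`. -/
def waitingTime (a T : ℕ) : ℕ := 2 ^ (a / 18) - 1 - T % 2 ^ (a / 18)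

/-- Multiples of the larger power of two are multiples of the smaller one. Doubling the modulus adds
`2 ^ i` to the period and at most `2 ^ i` to the remainder. -/
theorem waitingTime_mono {a a' : ℕ} (h : a' ≤ a) (T : ℕ) : waitingTime a' T ≤ waitingTime a T := by
  have key : ∀ i k : ℕ, 2 ^ i - 1 - T % 2 ^ i ≤ 2 ^ (i + k) - 1 - T % 2 ^ (i + k) := by
    intro i k
    induction k with
    | zero => simp
    | succ k ih =>
      refine ih.trans ?_
      have h1 : 2 ^ (i + (k + 1)) = 2 ^ (i + k) * 2 := by ring
      rw [h1, Nat.mod_mul]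
      have h2 : T % 2 ^ (i + k) < 2 ^ (i + k) := Nat.mod_lt _ (by positivity)
      have h3 : T / 2 ^ (i + k) % 2 < 2 := Nat.mod_lt _ (by norm_num)
      have h4 : 2 ^ (i + k) * (T / 2 ^ (i + k) % 2) ≤ 2 ^ (i + k) * 1 :=
        Nat.mul_le_mul_left _ (by omega)
      omega
  have := key (a' / 18) (a / 18 - a' / 18)
  rwa [Nat.add_sub_of_le (Nat.div_le_div_right h)] at this

/-- An unchecked position means that `2 ^ (a / 18)` does not divide `T + 1`, so the remainder of `T`
increases without wrapping around. -/
theorem waitingTime_succ {a T : ℕ} (h : checkDepth 18 (T + 1) ≤ a) :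
    waitingTime a (T + 1) + 1 = waitingTime a T := by
  unfold checkDepth at h
  unfold waitingTime
  set k := a / 18 with hk
  have h1 : padicValNat 2 (T + 1) < k := by omega
  have h2 : ¬ 2 ^ k ∣ T + 1 := by
    rw [padicValNat_dvd_iff_le (by omega)]; omega
  have h3 : T % 2 ^ k < 2 ^ k := Nat.mod_lt _ (by positivity)
  have h5 : (T + 1) % 2 ^ k = (T % 2 ^ k + 1) % 2 ^ k := by simp
  have h6 : T % 2 ^ k + 1 ≠ 2 ^ k := by
    intro h7
    rw [h7, Nat.mod_self] at h5
    exact h2 (Nat.dvd_of_mod_eq_zero h5)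
  rw [h5, Nat.mod_eq_of_lt (by omega : T % 2 ^ k + 1 < 2 ^ k)]
  omega

/-- Three factors 4/3 exceed 2. The strict inequality gets the growth started even from `B 0 = 0`,
which the `+ 1` allows for. -/
theorem two_pow_le_of_growth {B : ℕ → ℕ} {n : ℕ} (hB : ∀ i, i + 2 ≤ n → 4 * B i < 3 * B (i + 2))
    (j : ℕ) (hj : 6 * j ≤ n) : 2 ^ j ≤ B (6 * j) + 1 := by
  induction j with
  | zero => simp
  | succ j ih =>
    have h1 := hB (6 * j) (by omega)
    have h2 := hB (6 * j + 2) (by omega)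
    have h3 := hB (6 * j + 4) (by omega)
    have h4 := ih (by omega)
    have h5 : 6 * (j + 1) = 6 * j + 4 + 2 := by ring
    rw [show 6 * j + 2 + 2 = 6 * j + 4 by ring] at h2
    rw [h5, pow_succ]
    omega

theorem sum_take_mono (L : List ℕ) {i j : ℕ} (h : i ≤ j) : (L.take i).sum ≤ (L.take j).sum := by
  have : L.take i = (L.take j).take i := by rw [List.take_take, min_eq_left h]
  rw [this]
  exact (List.take_sublist _ _).sum_le_sum (by simp)

/-- If all pairs are balanced, then the pairs with few elements between them and the left boundary
are checked often. -/
theorem waitingTime_le_of_balanced {q' : Bool} {L : List ℕ}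
    (hL : ForallPairs (fun _ s z _ r => outside true q' s r < 3 * z) L) (T : ℕ)
    {A B : List ℕ} {x y : ℕ} (hA : L = A ++ x :: y :: B) (hs : q' = true → A.sum ≤ B.sum) :
    4 * waitingTime A.length T ≤ A.sum + (x + y) := by
  rw [forallPairs_iff_index] at hL
  have hlen : L.length = A.length + 2 + B.length := by simp [hA]; omega
  have htake : ∀ i, (L.take i).sum + (L.drop i).sum = L.sum := fun i => by
    rw [← List.sum_append, List.take_append_drop]
  have hBt : L.drop (A.length + 2) = B := by rw [hA, List.drop_append]; simp
  have hAt : L.take A.length = A := by rw [hA]; simp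
  have hLs : L.sum = A.sum + (x + y) + B.sum := by rw [hA]; simp; omega
  have htwo : (L.take (A.length + 2)).sum = A.sum + (x + y) := by
    have := htake (A.length + 2)
    rw [hBt] at this
    omega
  have hgrow : ∀ i, i + 2 ≤ A.length + 2 →
      4 * (L.take i).sum < 3 * (L.take (i + 2)).sum := by
    intro i hi
    have h1 := hL i (by omega)
    have h2 : (L.take (i + 2)).sum = (L.take i).sum + (L.getD i 0 + L.getD (i + 1) 0) := by
      rw [List.getD_eq_getElem _ _ (by omega), List.getD_eq_getElem _ _ (by omega),
        List.sum_take_succ _ _ (by omega), List.sum_take_succ _ _ (by omega)]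
      omega
    -- All pairs up to the given one are nearer to the left end, so the minimum is attained on the
    -- left.
    have h3 : outside true q' (L.take i).sum (L.drop (i + 2)).sum = (L.take i).sum := by
      cases q' with
      | false => rfl
      | true =>
        have h4 := htake (i + 2)
        have h5 := sum_take_mono L (show i ≤ A.length by omega)
        have h6 := sum_take_mono L hi
        rw [hAt] at h5
        have h7 := hs rfl
        simp only [outside]
        omega
    rw [h3] at h1
    omega
  -- Eighteen intervals are three doublings, so the prefix is of order `8 ^ k` while the waiting
  -- time is below `2 ^ k`; this margin absorbs the factor 4 for every `k`.
  set k := A.length / 18 with hk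
  have h1 := two_pow_le_of_growth hgrow (3 * k) (by omega)
  have h2 := sum_take_mono L (show 6 * (3 * k) ≤ A.length + 2 by omega)
  rw [htwo] at h2
  have h3 : 4 * 2 ^ k ≤ 2 ^ (3 * k) + 3 := by
    rcases Nat.eq_zero_or_pos k with h | h
    · simp [h]
    · have h4 : 2 ^ (3 * k) = 2 ^ (2 * k) * 2 ^ k := by rw [← pow_add]; ring_nf
      have h5 : 2 ^ 2 ≤ 2 ^ (2 * k) := Nat.pow_le_pow_right (by norm_num) (by omega)
      rw [h4]
      nlinarith [Nat.mul_le_mul_right (2 ^ k) h5]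
  have h4 : 1 ≤ 2 ^ k := Nat.one_le_two_pow
  unfold waitingTime
  rw [← hk]
  omega

/-- The invariant of strict merging: a pair is balanced within the factor `3`, even after the
updates that may happen until it is checked from one of the sides. -/
def StrictInv (q q' : Bool) (T a s z c r : ℕ) : Prop :=
  (q = true ∧ s + 4 * waitingTime a T < 3 * z) ∨ (q' = true ∧ r + 4 * waitingTime c T < 3 * z)

theorem StrictInv.outside_lt {q q' : Bool} {T a s z c r : ℕ} (h : StrictInv q q' T a s z c r) :
    outside q q' s r < 3 * z := by
  rcases h with ⟨rfl, h⟩ | ⟨rfl, h⟩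
  · cases q' <;> simp only [outside] <;> omega
  · cases q <;> simp only [outside] <;> omega

/-- Both alternatives give balance within the factor 3, hence geometric growth and `4 * w ≤ s + z`
towards the nearer queried end. With `s < z` for a pair that fails the merging condition, `s + 4 * w
< 3 * z` follows. -/
theorem forallPairs_strictInv {q q' : Bool} (hq : q = true ∨ q' = true) {T : ℕ} {L : List ℕ}
    (hL : ForallPairs
      (fun a s z c r => outside q q' s r < z ∨ StrictInv q q' T a s z c r) L) :
    ForallPairs (StrictInv q q' T) L := by
  have hbal : ForallPairs (fun _ s z _ r => outside q q' s r < 3 * z) L :=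
    hL.imp fun a s z c r h => h.elim (fun h => by omega) StrictInv.outside_lt
  have hbal' : ForallPairs (fun _ s z _ r => outside q' q s r < 3 * z) L.reverse :=
    hbal.reverse.imp fun a s z c r h => by rwa [outside_swap]
  intro A x y B hA
  rcases hL A x y B hA with h | h
  swap
  · exact h
  have hA' : L.reverse = B.reverse ++ y :: x :: A.reverse := by simp [hA]
  by_cases hl : q = true ∧ (q' = true → A.sum ≤ B.sum)
  · obtain ⟨rfl, hs⟩ := hl
    have h1 := waitingTime_le_of_balanced hbal T hA hs
    have h2 : outside true q' A.sum B.sum = A.sum := by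
      cases q' <;> simp_all [outside]
    exact Or.inl ⟨rfl, by omega⟩
  · have hr : q' = true ∧ (q = true → B.sum ≤ A.sum) := by
      cases q <;> cases q' <;> simp_all
      omega
    obtain ⟨rfl, hs⟩ := hr
    have h1 := waitingTime_le_of_balanced hbal' T hA' (by simpa using hs)
    have h2 : outside q true A.sum B.sum = B.sum := by
      cases q <;> simp_all [outside]
    simp only [List.length_reverse, List.sum_reverse] at h1
    exact Or.inr ⟨rfl, by omega⟩

/-- One round of strict merging on the level of sizes. -/
theorem forallPairs_round {q q' : Bool} (hq : q = true ∨ q' = true) {T : ℕ} {L : List ℕ}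
    (hL : ForallPairs (fun a s z c r => (q = true ∧ s + 4 * waitingTime a T < 3 * z + 4) ∨
      (q' = true ∧ r + 4 * waitingTime c T < 3 * z + 4)) L) :
    ForallPairs (StrictInv q q' (T + 1))
      (mergeSizes q' q (checkDepth 18 (T + 1)) 0
        (mergeSizes q q' (checkDepth 18 (T + 1)) 0 L).reverse).reverse := by
  apply forallPairs_strictInv hq
  -- The left pass repays the slack 4 only for pairs that the invariant tracks from the left; those
  -- tracked from the right keep it until the right pass.
  have h1 := forallPairs_mergeSizes (q := q) (q' := q')
    (Q := fun a s z c r => outside q q' s r < z ∨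
      (q = true ∧ s + 4 * waitingTime a (T + 1) < 3 * z) ∨
      (q' = true ∧ r + 4 * waitingTime c T < 3 * z + 4))
    (by
      intro a a' s s' z z' c c' r r' ha hs hz hc hr h
      have := outside_mono q q' hs hr
      have := waitingTime_mono ha (T + 1)
      have := waitingTime_mono hc T
      rcases h with h | ⟨hq, h⟩ | ⟨hq, h⟩
      · exact Or.inl (by omega)
      · exact Or.inr (Or.inl ⟨hq, by omega⟩)
      · exact Or.inr (Or.inr ⟨hq, by omega⟩))
    (fun a s z c r h => Or.inl h) (checkDepth 18 (T + 1)) 0 0 L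
    (hL.imp fun a s z c r h hf => by
      simp only [zero_add]
      rcases h with ⟨hq, h⟩ | ⟨hq, h⟩
      · have := waitingTime_succ hf
        exact Or.inr (Or.inl ⟨hq, by omega⟩)
      · exact Or.inr (Or.inr ⟨hq, h⟩))
  have h2 := forallPairs_mergeSizes (q := q') (q' := q)
    (Q := fun a s z c r => outside q' q s r < z ∨ StrictInv q' q (T + 1) a s z c r)
    (by
      intro a a' s s' z z' c c' r r' ha hs hz hc hr h
      have := outside_mono q' q hs hr
      have := waitingTime_mono ha (T + 1)
      have := waitingTime_mono hc (T + 1)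
      rcases h with h | ⟨hq, h⟩ | ⟨hq, h⟩
      · exact Or.inl (by omega)
      · exact Or.inr (Or.inl ⟨hq, by omega⟩)
      · exact Or.inr (Or.inr ⟨hq, by omega⟩))
    (fun a s z c r h => Or.inl h) (checkDepth 18 (T + 1)) 0 0
    (mergeSizes q q' (checkDepth 18 (T + 1)) 0 L).reverse
    (h1.reverse.imp fun a s z c r h hf => by
      simp only [zero_add] at *
      rw [outside_swap]
      rcases h with h | ⟨hq, h⟩ | ⟨hq, h⟩
      · exact Or.inl h
      · exact Or.inr (Or.inr ⟨hq, by omega⟩)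
      · have := waitingTime_succ hf
        exact Or.inr (Or.inl ⟨hq, by omega⟩))
  refine h2.reverse.imp fun a s z c r h => ?_
  simp only [zero_add] at h
  rw [outside_swap] at h
  exact h.imp_right Or.symm

/-! ### Changing one entry of a list of sizes -/

theorem sum_take_modify_succ (L : List ℕ) (i t : ℕ) :
    ((L.modify i (· + 1)).take t).sum ≤ (L.take t).sum + 1 := by
  induction L generalizing i t with
  | nil => simp
  | cons x L ih =>
    cases t with
    | zero => simp
    | succ t =>
      cases i with
      | zero => simp; omega
      | succ i => have := ih i t; simp; omega

theorem sum_drop_modify_succ (L : List ℕ) (i t : ℕ) :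
    ((L.modify i (· + 1)).drop t).sum ≤ (L.drop t).sum + 1 := by
  induction L generalizing i t with
  | nil => simp
  | cons x L ih =>
    cases t with
    | zero =>
      cases i with
      | zero => simp; omega
      | succ i => have := ih i 0; simp at *; omega
    | succ t =>
      cases i with
      | zero => simp
      | succ i => have := ih i t; simp; omega

theorem getD_modify_succ (L : List ℕ) (i t : ℕ) :
    L.getD t 0 ≤ (L.modify i (· + 1)).getD t 0 := by
  induction L generalizing i t with
  | nil => simp
  | cons x L ih =>
    cases t <;> cases i <;> simp at *
    apply ih

theorem sum_take_modify_pred (L : List ℕ) (i t : ℕ) :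
    ((L.modify i (· - 1)).take t).sum ≤ (L.take t).sum := by
  induction L generalizing i t with
  | nil => simp
  | cons x L ih =>
    cases t with
    | zero => simp
    | succ t =>
      cases i with
      | zero => simp
      | succ i => have := ih i t; simp; omega

theorem sum_drop_modify_pred (L : List ℕ) (i t : ℕ) :
    ((L.modify i (· - 1)).drop t).sum ≤ (L.drop t).sum := by
  induction L generalizing i t with
  | nil => simp
  | cons x L ih =>
    cases t with
    | zero =>
      cases i with
      | zero => simp
      | succ i => have := ih i 0; simp at *; omega
    | succ t =>
      cases i with
      | zero => simp
      | succ i => have := ih i t; simp; omega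

theorem getD_pair_modify_pred (L : List ℕ) (i t : ℕ) :
    L.getD t 0 + L.getD (t + 1) 0 ≤
      (L.modify i (· - 1)).getD t 0 + (L.modify i (· - 1)).getD (t + 1) 0 + 1 := by
  induction L generalizing i t with
  | nil => simp
  | cons x L ih =>
    cases t with
    | zero =>
      cases i with
      | zero => simp; omega
      | succ i =>
        cases L with
        | nil => simp
        | cons y L => cases i <;> simp; omega
    | succ t =>
      cases i with
      | zero => simp
      | succ i => simpa using ih i t

/-! ### Exponential search -/

/-- Monotonicity of `ok` is not needed: the search keeps a false left end and a true right end, so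
it ends at a switch. Bounding the steps by the length of the stretch suffices. -/
theorem binarySearch_spec (ok : ℕ → Bool) (a b : ℕ) (hab : a < b) (ha : ok a = false)
    (hb : ok b = true) :
    a < (binarySearch ok a b).1 ∧ (binarySearch ok a b).1 ≤ b ∧
      ok (binarySearch ok a b).1 = true ∧ ok ((binarySearch ok a b).1 - 1) = false ∧
      (binarySearch ok a b).2 ≤ b - a := by
  fun_induction binarySearch ok a b with
  | case1 a b h =>
    have : b - 1 = a := by omega
    simp [*]
  | case2 a b h hm res ih =>
    have := ih (by omega) ha hm
    simp only [res] at *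
    grind
  | case3 a b h hm res ih =>
    have := ih (by omega) (by simpa using hm) hb
    simp only [res] at *
    grind

/-- Exponential search finds a distance at which `ok` changes to true, in a number of steps at most
linear in that distance. -/
theorem gallop_spec (ok : ℕ → Bool) (m d : ℕ) (hd : 0 < d) (hdm : d / 2 < m)
    (h0 : ok (d / 2) = false) (hm : ok m = true) :
    d / 2 < (gallop ok m d).1 ∧ (gallop ok m d).1 ≤ m ∧
      ok (gallop ok m d).1 = true ∧ ok ((gallop ok m d).1 - 1) = false ∧
      (gallop ok m d).2 + d ≤ 3 * (gallop ok m d).1 := by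
  -- The summand `d` is a potential: passing to `2 * d` pays for one more inspection. In the last
  -- stretch the binary search costs at most its length, and the result exceeds `d / 2`.
  fun_induction gallop ok m d with
  | case1 d h res =>
    obtain ⟨h1, h2, h3, h4, h5⟩ := binarySearch_spec ok (d / 2) m hdm h0 hm
    refine ⟨h1, h2, h3, h4, ?_⟩
    simp only [res]
    omega
  | case2 d h hok res =>
    obtain ⟨h1, h2, h3, h4, h5⟩ := binarySearch_spec ok (d / 2) d (by omega) h0 hok
    refine ⟨h1, by simp only [res]; omega, h3, h4, ?_⟩
    simp only [res]
    omega
  | case3 d h hok res ih =>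
    have hdd : 2 * d / 2 = d := by omega
    rw [hdd] at ih
    obtain ⟨h1, h2, h3, h4, h5⟩ := ih (by omega) (by omega) (by simpa using hok)
    refine ⟨by simp only [res]; omega, h2, h3, h4, ?_⟩
    simp only [res]
    omega

/-! ### Prefix counts and the effect of updates on elements, sizes and splitting keys -/

section Sizes

variable {κ : Type u} {ν : Type v}

theorem Gap.before_succ (G : Gap κ ν) (t : ℕ) : G.before (t + 1) = G.before t + G.sizeAt t := by
  unfold Gap.before Gap.sizeAt
  by_cases h : t < (G.ivals.map Interval.size).length
  · rw [List.getD_eq_getElem _ _ h, List.sum_take_succ _ _ h]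
  · rw [List.getD_eq_default _ _ (by omega), List.take_of_length_le (by omega),
      List.take_of_length_le (by omega), add_zero]

theorem Gap.before_add_after (G : Gap κ ν) (t : ℕ) : G.before (t + 1) + G.after t = G.size := by
  unfold Gap.before Gap.after Gap.size
  rw [← List.sum_append, List.take_append_drop]

theorem Gap.before_mono (G : Gap κ ν) {s t : ℕ} (h : s ≤ t) : G.before s ≤ G.before t :=
  sum_take_mono _ h

theorem Gap.PointsTo.lt_length {G : Gap κ ν} {j p : ℕ} {e : κ × ν} (he : G.PointsTo j p e) :
    j < G.ivals.length := by
  obtain ⟨I, hI, -⟩ := he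
  exact (List.getElem?_eq_some_iff.1 hI).1

theorem Gap.exists_eq_append {G : Gap κ ν} {t : ℕ} {I : Interval κ ν} (h : G.ivals[t]? = some I) :
    ∃ A B, G.ivals = A ++ I :: B ∧ A.length = t := by
  obtain ⟨ht, rfl⟩ := List.getElem?_eq_some_iff.1 h
  exact ⟨G.ivals.take t, G.ivals.drop (t + 1), by simp, by simp; omega⟩

theorem modify_append_cons {α : Type*} (A B : List α) (x : α) (f : α → α) :
    (A ++ x :: B).modify A.length f = A ++ f x :: B := by
  induction A with
  | nil => simp
  | cons a A ih => simpa using ih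

theorem map_modify_of_comm {α β : Type*} {f : α → α} {g : α → β} {h : β → β} (L : List α) (i : ℕ)
    (hfg : ∀ x ∈ L[i]?, g (f x) = h (g x)) : (L.modify i f).map g = (L.map g).modify i h := by
  induction L generalizing i with
  | nil => simp
  | cons a L ih =>
    cases i with
    | zero => simpa using hfg
    | succ i => simpa using ih i (by simpa using hfg)

theorem Gap.elems_insertAt {G : Gap κ ν} {t : ℕ} (ht : t < G.ivals.length) (e : κ × ν) :
    (G.insertAt t e).elems.Perm (e :: G.elems) := by
  obtain ⟨A, B, hAB, rfl⟩ := G.exists_eq_append (List.getElem?_eq_getElem ht)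
  unfold Gap.insertAt Gap.elems
  simp only
  rw [hAB, modify_append_cons]
  simp only [List.flatMap_append, List.flatMap_cons, List.cons_append]
  exact List.perm_middle

theorem Gap.elems_removeAt {G : Gap κ ν} {j p : ℕ} {e : κ × ν} (h : G.PointsTo j p e) :
    G.elems.Perm (e :: (G.removeAt j p).elems) := by
  obtain ⟨I, hI, hp⟩ := h
  obtain ⟨A, B, hAB, rfl⟩ := G.exists_eq_append hI
  unfold Gap.removeAt Gap.elems
  simp only
  rw [hAB, modify_append_cons]
  simp only [List.flatMap_append, List.flatMap_cons]
  obtain ⟨hp', rfl⟩ := List.getElem?_eq_some_iff.1 hp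
  have h1 : I.elems.Perm (I.elems[p] :: I.elems.eraseIdx p) :=
    (List.getElem_cons_eraseIdx_perm hp').symm
  refine (List.Perm.append_left _ (List.Perm.append_right _ h1)).trans ?_
  simp only [List.cons_append]
  exact List.perm_middle

theorem Gap.map_size_removeAt {G : Gap κ ν} {j p : ℕ} {e : κ × ν} (h : G.PointsTo j p e) :
    (G.removeAt j p).ivals.map Interval.size =
      (G.ivals.map Interval.size).modify j (· - 1) := by
  obtain ⟨I, hI, hp⟩ := h
  obtain ⟨hp', -⟩ := List.getElem?_eq_some_iff.1 hp
  refine map_modify_of_comm _ _ fun x hx => ?_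
  rw [hI] at hx
  obtain rfl : I = x := by simpa using hx
  simp [Interval.size, List.length_eraseIdx_of_lt hp']

theorem Gap.map_size_insertAt (G : Gap κ ν) (t : ℕ) (e : κ × ν) :
    (G.insertAt t e).ivals.map Interval.size =
      (G.ivals.map Interval.size).modify t (· + 1) :=
  map_modify_of_comm _ _ fun x _ => by simp [Interval.size]

/-- The splitting keys of an interval. -/
def Interval.frame (I : Interval κ ν) : WithBot κ × WithTop κ := (I.lo, I.hi)

theorem Gap.map_frame_removeAt (G : Gap κ ν) (j p : ℕ) :
    (G.removeAt j p).ivals.map Interval.frame = G.ivals.map Interval.frame :=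
  by
  refine (map_modify_of_comm (g := Interval.frame) (h := id) _ _ fun x _ => ?_).trans ?_
  · rfl
  · simp

theorem Gap.map_frame_insertAt (G : Gap κ ν) (t : ℕ) (e : κ × ν) :
    (G.insertAt t e).ivals.map Interval.frame = G.ivals.map Interval.frame :=
  by
  refine (map_modify_of_comm (g := Interval.frame) (h := id) _ _ fun x _ => ?_).trans ?_
  · rfl
  · simp

theorem Gap.length_removeAt (G : Gap κ ν) (j p : ℕ) :
    (G.removeAt j p).ivals.length = G.ivals.length := by
  simp [Gap.removeAt]

end Sizes

section Ordered

variable {κ : Type u} {ν : Type v} [LinearOrder κ]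

/-! ### Well-formedness -/

/-- The conditions on the splitting keys in a well-formed gap. -/
structure FrameOK (F : List (WithBot κ × WithTop κ)) : Prop where
  ne_nil : F ≠ []
  head_lo : ∀ I ∈ F.head?, I.1 = ⊥
  last_hi : ∀ I ∈ F.getLast?, I.2 = ⊤
  chain : F.IsChain fun I J => ∃ k : κ, I.2 = (k : WithTop κ) ∧ J.1 = (k : WithBot κ)
  sorted : ∀ I ∈ F, ∀ a b : κ, I.1 = (a : WithBot κ) → I.2 = (b : WithTop κ) → a ≤ b

/-- Separates the conditions on the splitting keys, which removals and insertions leave alone, from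
those on the elements. -/
theorem Gap.wellFormed_iff {G : Gap κ ν} :
    G.WellFormed ↔ FrameOK (G.ivals.map Interval.frame) ∧
      (∀ I ∈ G.ivals, ∀ e ∈ I.elems, I.lo ≤ (e.1 : WithBot κ) ∧ (e.1 : WithTop κ) ≤ I.hi) ∧
      ∀ e ∈ G.elems, G.InRange e.1 := by
  constructor
  · rintro ⟨h1, h2, h3, h4, h5, h6, h7⟩
    refine ⟨⟨by simpa using h1, ?_, ?_, ?_, ?_⟩, h6, h7⟩
    · simpa [Interval.frame] using h2
    · simpa [Interval.frame] using h3
    · rw [List.isChain_map]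
      exact h4
    · intro I hI
      obtain ⟨I, hI', rfl⟩ := List.mem_map.1 hI
      exact h5 I hI'
  · rintro ⟨⟨h1, h2, h3, h4, h5⟩, h6, h7⟩
    refine ⟨by simpa using h1, ?_, ?_, ?_, ?_, h6, h7⟩
    · simpa [Interval.frame] using h2
    · simpa [Interval.frame] using h3
    · rw [List.isChain_map] at h4
      exact h4
    · exact fun I hI => h5 _ (List.mem_map_of_mem hI)

theorem Gap.WellFormed.removeAt {G : Gap κ ν} (hG : G.WellFormed) (j p : ℕ) :
    (G.removeAt j p).WellFormed := by
  rw [Gap.wellFormed_iff] at hG ⊢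
  obtain ⟨h1, h2, h3⟩ := hG
  have hsub : ∀ I ∈ (G.removeAt j p).ivals, ∃ J ∈ G.ivals,
      J.lo = I.lo ∧ J.hi = I.hi ∧ ∀ e ∈ I.elems, e ∈ J.elems := by
    intro I hI
    obtain ⟨i, hi⟩ := List.mem_iff_getElem?.1 hI
    simp only [Gap.removeAt, List.getElem?_modify] at hi
    obtain ⟨J, hJ, rfl⟩ := Option.map_eq_some_iff.1 hi
    refine ⟨J, List.mem_iff_getElem?.2 ⟨i, hJ⟩, ?_⟩
    split_ifs
    · exact ⟨rfl, rfl, fun e he => List.mem_of_mem_eraseIdx he⟩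
    · exact ⟨rfl, rfl, fun e he => he⟩
  refine ⟨by rwa [Gap.map_frame_removeAt], fun I hI e he => ?_, fun e he => ?_⟩
  · obtain ⟨J, hJ, hlo, hhi, hel⟩ := hsub I hI
    rw [← hlo, ← hhi]
    exact h2 J hJ e (hel e he)
  · obtain ⟨I, hI, he⟩ := List.mem_flatMap.1 he
    obtain ⟨J, hJ, -, -, hel⟩ := hsub I hI
    exact h3 e (List.mem_flatMap.2 ⟨J, hJ, hel e he⟩)

theorem Gap.WellFormed.insertAt {G : Gap κ ν} (hG : G.WellFormed) {t : ℕ} {I : Interval κ ν}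
    {e : κ × ν} (hI : G.ivals[t]? = some I) (hk : G.InRange e.1)
    (hlo : I.lo ≤ (e.1 : WithBot κ)) (hhi : (e.1 : WithTop κ) ≤ I.hi) :
    (G.insertAt t e).WellFormed := by
  rw [Gap.wellFormed_iff] at hG ⊢
  obtain ⟨h1, h2, h3⟩ := hG
  refine ⟨by rwa [Gap.map_frame_insertAt], fun J hJ e' he' => ?_, fun e' he' => ?_⟩
  · obtain ⟨i, hi⟩ := List.mem_iff_getElem?.1 hJ
    simp only [Gap.insertAt, List.getElem?_modify] at hi
    obtain ⟨J, hJ', rfl⟩ := Option.map_eq_some_iff.1 hi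
    have hmem : J ∈ G.ivals := List.mem_iff_getElem?.2 ⟨i, hJ'⟩
    split_ifs at he' ⊢ with hti
    · subst hti
      obtain rfl : I = J := by simpa [hI] using hJ'
      rcases List.mem_cons.1 he' with rfl | he'
      · exact ⟨hlo, hhi⟩
      · exact h2 I hmem e' he'
    · exact h2 J hmem e' he'
  · have ht : t < G.ivals.length := (List.getElem?_eq_some_iff.1 hI).1
    rcases List.mem_cons.1 ((G.elems_insertAt ht e).mem_iff.1 he') with rfl | he'
    · exact hk
    · exact h3 e' he'

/-- The shared splitting key `k` satisfies `I.lo ≤ k ≤ J.hi` by sortedness, so the elements of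
either part respect the outer bound of the other. -/
theorem Gap.WellFormed.union {G : Gap κ ν} (hG : G.WellFormed) {A B : List (Interval κ ν)}
    {I J : Interval κ ν} (h : G.ivals = A ++ I :: J :: B) :
    Gap.WellFormed { G with ivals := A ++ I.union J :: B } := by
  obtain ⟨h1, h2, h3, h4, h5, h6, h7⟩ := hG
  rw [h] at h2 h3 h4 h5 h6
  obtain ⟨k, hk1, hk2⟩ : ∃ k : κ, I.hi = (k : WithTop κ) ∧ J.lo = (k : WithBot κ) := by
    simp only [List.isChain_append, List.isChain_cons_cons] at h4
    exact h4.2.1.1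
  have hIlo : ∀ a : κ, I.lo = (a : WithBot κ) → a ≤ k := fun a ha => h5 I (by simp) a k ha hk1
  have hJhi : ∀ b : κ, J.hi = (b : WithTop κ) → k ≤ b := fun b hb => h5 J (by simp) k b hk2 hb
  refine ⟨by simp, ?_, ?_, ?_, ?_, ?_, ?_⟩
  · cases A with
    | nil => simpa [Interval.union] using h2
    | cons => simpa using h2
  · cases B using List.reverseRecOn with
    | nil => simpa [Interval.union] using h3
    | append_singleton B b =>
      have e1 : A ++ I.union J :: (B ++ [b]) = (A ++ I.union J :: B) ++ [b] := by simp
      have e2 : A ++ I :: J :: (B ++ [b]) = (A ++ I :: J :: B) ++ [b] := by simp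
      simp only [e1]
      rw [e2, List.getLast?_concat] at h3
      rw [List.getLast?_concat]
      exact h3
  · simp only [List.isChain_append, List.isChain_cons, List.head?_cons] at h4 ⊢
    refine ⟨h4.1, ⟨h4.2.1.2.1, h4.2.1.2.2⟩, ?_⟩
    intro x hx y hy
    obtain rfl : I.union J = y := by simpa using hy
    exact h4.2.2 x hx I (by simp)
  · intro X hX a b ha hb
    have : X = I.union J ∨ X ∈ A ++ I :: J :: B := by
      simp at hX ⊢; tauto
    rcases this with rfl | hX
    · exact (hIlo a ha).trans (hJhi b hb)
    · exact h5 X hX a b ha hb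
  · intro X hX e he
    have : X = I.union J ∨ X ∈ A ++ I :: J :: B := by
      simp at hX ⊢; tauto
    rcases this with rfl | hX
    · rcases List.mem_append.1 he with he | he
      · have h8 := h6 I (by simp) e he
        refine ⟨h8.1, ?_⟩
        have h9 : e.1 ≤ k := by simpa [hk1] using h8.2
        change (e.1 : WithTop κ) ≤ J.hi
        cases hJ : J.hi with
        | top => simp
        | coe b => exact WithTop.coe_le_coe.2 (h9.trans (hJhi b hJ))
      · have h8 := h6 J (by simp) e he
        refine ⟨?_, h8.2⟩
        have h9 : k ≤ e.1 := by simpa [hk2] using h8.1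
        change I.lo ≤ (e.1 : WithBot κ)
        cases hI : I.lo with
        | bot => simp
        | coe a => exact WithBot.coe_le_coe.2 ((hIlo a hI).trans h9)
    · exact h6 X hX e he
  · intro e he
    refine h7 e ?_
    simpa [Gap.elems, Interval.union, h] using he

theorem Gap.WellFormed.mergePass_left {G : Gap κ ν} (q q' : Bool) (f s : ℕ)
    (A L : List (Interval κ ν)) (h : Gap.WellFormed { G with ivals := A ++ L }) :
    Gap.WellFormed { G with ivals := A ++ (mergePass Interval.union q q' f s L).1 } := by
  fun_induction mergePass Interval.union q q' f s L generalizing A with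
  | case1 => exact h
  | case2 => exact h
  | case3 => exact h
  | case4 s f I J L hc res ih => exact ih A (h.union rfl)
  | case5 s f I J L hc res ih =>
    simpa using ih (A ++ [I]) (by simpa using h)

theorem Gap.WellFormed.mergePass_right {G : Gap κ ν} (q q' : Bool) (f s : ℕ)
    (A L : List (Interval κ ν)) (h : Gap.WellFormed { G with ivals := L.reverse ++ A }) :
    Gap.WellFormed { G with ivals :=
      (mergePass (fun I J => Interval.union J I) q q' f s L).1.reverse ++ A } := by
  fun_induction mergePass (fun I J => Interval.union J I) q q' f s L generalizing A with
  | case1 => exact h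
  | case2 => exact h
  | case3 => exact h
  | case4 s f I J L hc res ih =>
    refine ih A ?_
    have := h.union (A := L.reverse) (B := A) (I := J) (J := I) (by simp)
    simpa using this
  | case5 s f I J L hc res ih =>
    simpa using ih (I :: A) (by simpa using h)

theorem Gap.WellFormed.mergeOuter {G : Gap κ ν} (hG : G.WellFormed) (d : ℕ) :
    (G.mergeOuter d).1.WellFormed := by
  have h1 := Gap.WellFormed.mergePass_left (G := G) G.queriedLeft G.queriedRight d 0 [] G.ivals hG
  have h2 := Gap.WellFormed.mergePass_right (G := G) G.queriedRight G.queriedLeft d 0 []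
    (mergePass Interval.union G.queriedLeft G.queriedRight d 0 G.ivals).1.reverse
    (by simpa using h1)
  simpa [Gap.mergeOuter] using h2

/-! ### The search for the new interval -/

theorem Gap.WellFormed.loLE_pred {G : Gap κ ν} (hG : G.WellFormed) {k : κ} {i : ℕ}
    (hi : i + 1 < G.ivals.length) (h : G.loLE k (i + 1) = true) : G.loLE k i = true := by
  obtain ⟨a, h1, h2⟩ := List.isChain_iff_getElem.1 hG.chain i hi
  have h3 : i < G.ivals.length := by omega
  simp only [Gap.loLE, List.getElem?_eq_getElem hi, List.getElem?_eq_getElem h3,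
    decide_eq_true_eq] at h ⊢
  rw [h2] at h
  cases hl : G.ivals[i].lo with
  | bot => simp
  | coe b =>
    refine le_trans (WithBot.coe_le_coe.2 ?_) h
    exact hG.sorted _ (List.getElem_mem h3) b a hl h1

theorem Gap.WellFormed.leHi_succ {G : Gap κ ν} (hG : G.WellFormed) {k : κ} {i : ℕ}
    (hi : i + 1 < G.ivals.length) (h : G.leHi k i = true) : G.leHi k (i + 1) = true := by
  obtain ⟨a, h1, h2⟩ := List.isChain_iff_getElem.1 hG.chain i hi
  have h3 : i < G.ivals.length := by omega
  simp only [Gap.leHi, List.getElem?_eq_getElem hi, List.getElem?_eq_getElem h3,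
    decide_eq_true_eq] at h ⊢
  rw [h1] at h
  cases hl : G.ivals[i + 1].hi with
  | top => simp
  | coe b =>
    refine h.trans (WithTop.coe_le_coe.2 ?_)
    exact hG.sorted _ (List.getElem_mem hi) a b h2 hl

/-- The two inspections compare `k` with the same splitting key. Hence where one of them switches,
the other one holds, and the interval found contains `k`. -/
theorem Gap.WellFormed.loLE_succ_or_leHi {G : Gap κ ν} (hG : G.WellFormed) (k : κ) {i : ℕ}
    (hi : i + 1 < G.ivals.length) : G.loLE k (i + 1) = true ∨ G.leHi k i = true := by
  obtain ⟨a, h1, h2⟩ := List.isChain_iff_getElem.1 hG.chain i hi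
  have h3 : i < G.ivals.length := by omega
  simp only [Gap.loLE, Gap.leHi, List.getElem?_eq_getElem hi, List.getElem?_eq_getElem h3,
    decide_eq_true_eq, h1, h2, WithBot.coe_le_coe, WithTop.coe_le_coe]
  exact le_total a k

theorem Gap.WellFormed.length_pos {G : Gap κ ν} (hG : G.WellFormed) : 0 < G.ivals.length :=
  List.length_pos_of_ne_nil hG.ne_nil

theorem Gap.WellFormed.loLE_zero {G : Gap κ ν} (hG : G.WellFormed) (k : κ) :
    G.loLE k 0 = true := by
  have h0 := hG.length_pos
  have h := hG.head_lo G.ivals[0] (by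
    rw [List.head?_eq_getElem?, List.getElem?_eq_getElem hG.length_pos]; simp)
  simp [Gap.loLE, List.getElem?_eq_getElem hG.length_pos, h]

theorem Gap.WellFormed.leHi_last {G : Gap κ ν} (hG : G.WellFormed) (k : κ) :
    G.leHi k (G.ivals.length - 1) = true := by
  have h0 := hG.length_pos
  have h1 : G.ivals.length - 1 < G.ivals.length := by omega
  have h := hG.last_hi G.ivals[G.ivals.length - 1] (by
    rw [List.getLast?_eq_getElem?, List.getElem?_eq_getElem h1]; simp)
  simp [Gap.leHi, List.getElem?_eq_getElem h1, h]

/-- The search finds an interval `t` to which `k` belongs, the nearest one to `j`. -/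
theorem Gap.WellFormed.search_spec {G : Gap κ ν} (hG : G.WellFormed) {j : ℕ}
    (hj : j < G.ivals.length) (k : κ) :
    (G.search j k).1 < G.ivals.length ∧ G.loLE k (G.search j k).1 = true ∧
      G.leHi k (G.search j k).1 = true ∧
      ((G.search j k).1 < j → G.loLE k ((G.search j k).1 + 1) = false) ∧
      (j < (G.search j k).1 → G.leHi k ((G.search j k).1 - 1) = false) ∧
      (G.search j k).2 ≤ 2 + 3 * ((G.search j k).1 - j + (j - (G.search j k).1)) := by
  unfold Gap.search
  split_ifs with h1 h2
  · simp [hj, h1, h2]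
  · have h3 : j < G.ivals.length - 1 := by
      rcases Nat.lt_or_ge j (G.ivals.length - 1) with h | h
      · exact h
      · obtain rfl : j = G.ivals.length - 1 := by omega
        exact absurd (hG.leHi_last k) h2
    have h4 : j + (G.ivals.length - 1 - j) = G.ivals.length - 1 := by omega
    obtain ⟨g1, g2, g3, g4, g5⟩ := gallop_spec (fun d => G.leHi k (j + d))
      (G.ivals.length - 1 - j) 1 one_pos (by simp; omega) (by simpa using h2)
      (by simp only [h4]; exact hG.leHi_last k)
    generalize gallop (fun d => G.leHi k (j + d)) (G.ivals.length - 1 - j) 1 = res at *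
    simp only at g1 g3 g4 ⊢
    have h5 : j + (res.1 - 1) = j + res.1 - 1 := by omega
    have h6 : j + res.1 - 1 + 1 = j + res.1 := by omega
    rw [h5] at g4
    refine ⟨by omega, ?_, g3, fun h => by omega, fun _ => g4, by omega⟩
    have := hG.loLE_succ_or_leHi k (i := j + res.1 - 1) (by omega)
    rw [h6] at this
    simpa [g4] using this
  · have h3 : 0 < j := by
      rcases Nat.eq_zero_or_pos j with rfl | h
      · exact absurd (hG.loLE_zero k) h1
      · exact h
    obtain ⟨g1, g2, g3, g4, g5⟩ := gallop_spec (fun d => G.loLE k (j - d))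
      j 1 one_pos (by simpa using h3) (by simpa using h1) (by simpa using hG.loLE_zero k)
    generalize gallop (fun d => G.loLE k (j - d)) j 1 = res at *
    simp only at g1 g3 g4 ⊢
    have h5 : j - (res.1 - 1) = j - res.1 + 1 := by omega
    rw [h5] at g4
    refine ⟨by omega, g3, ?_, fun _ => g4, fun h => by omega, by omega⟩
    have := hG.loLE_succ_or_leHi k (i := j - res.1) (by omega)
    simpa [g4] using this

theorem Gap.changeKey_of_pointsTo {G : Gap κ ν} {j p : ℕ} {e : κ × ν} (he : G.PointsTo j p e)
    {k : κ} (hk : G.InRange k) :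
    G.changeKey j p k =
      (some ((G.removeAt j p).insertAt (G.search j k).1 (k, e.2)), (G.search j k).2 + 4) := by
  obtain ⟨I, hI, hp⟩ := he
  simp [Gap.changeKey, hk, hI, hp]

theorem Gap.changeKey_eq_some {G G' : Gap κ ν} {j p : ℕ} {k : κ}
    (h : (G.changeKey j p k).1 = some G') : G.InRange k ∧ ∃ e, G.PointsTo j p e := by
  unfold Gap.changeKey at h
  split_ifs at h with hk
  refine ⟨hk, ?_⟩
  cases hI : G.ivals[j]? with
  | none => simp [hI] at h
  | some I =>
    cases hp : I.elems[p]? with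
    | none => simp [hI, hp] at h
    | some e => exact ⟨e, I, hI, hp⟩

theorem Gap.WellFormed.insertAt_search {G : Gap κ ν} (hG : G.WellFormed) {j p : ℕ} {e : κ × ν}
    (he : G.PointsTo j p e) {k : κ} (hk : G.InRange k) :
    ((G.removeAt j p).insertAt (G.search j k).1 (k, e.2)).WellFormed := by
  obtain ⟨h1, h2, h3, -⟩ := hG.search_spec he.lt_length k
  generalize (G.search j k).1 = t at *
  simp only [Gap.loLE, Gap.leHi, List.getElem?_eq_getElem h1, decide_eq_true_eq] at h2 h3
  have h4 : t < (G.removeAt j p).ivals.length := by rwa [G.length_removeAt]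
  have h5 : (G.removeAt j p).ivals[t].frame = G.ivals[t].frame := by
    have := G.map_frame_removeAt j p
    have := congrArg (fun L => L[t]?) this
    simpa [h1, h4] using this
  simp only [Interval.frame, Prod.mk.injEq] at h5
  exact (hG.removeAt j p).insertAt (List.getElem?_eq_getElem h4) hk
    (by rw [h5.1]; exact h2) (by rw [h5.2]; exact h3)

/-- Change-key is performed correctly. -/
theorem Gap.WellFormed.changeKey_correct {G : Gap κ ν} (hG : G.WellFormed) {j p : ℕ} {e : κ × ν}
    (he : G.PointsTo j p e) {k : κ} (hk : G.InRange k) :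
    ∃ G' : Gap κ ν, (G.changeKey j p k).1 = some G' ∧ G'.WellFormed ∧
      (e :: G'.elems).Perm ((k, e.2) :: G.elems) := by
  refine ⟨_, by rw [Gap.changeKey_of_pointsTo he hk], hG.insertAt_search he hk, ?_⟩
  have h1 : (G.search j k).1 < (G.removeAt j p).ivals.length := by
    rw [G.length_removeAt]
    exact (hG.search_spec he.lt_length k).1
  refine (((G.removeAt j p).elems_insertAt h1 (k, e.2)).cons e).trans ?_
  refine (List.Perm.swap _ _ _).trans ?_
  exact ((Gap.elems_removeAt he).symm).cons _

end Ordered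

/-! ### Strict merging -/

/-- The effect of one update on the sizes of the intervals: the two sides of a pair grow by at most
one element, and the pair shrinks by at most one element. -/
structure UpdatedSizes (L L' : List ℕ) : Prop where
  length_eq : L'.length = L.length
  sum_take_le : ∀ t, (L'.take t).sum ≤ (L.take t).sum + 1
  sum_drop_le : ∀ t, (L'.drop t).sum ≤ (L.drop t).sum + 1
  getD_le : ∀ t, L.getD t 0 + L.getD (t + 1) 0 ≤ L'.getD t 0 + L'.getD (t + 1) 0 + 1

theorem updatedSizes_modify_succ (L : List ℕ) (i : ℕ) :
    UpdatedSizes L (L.modify i (· + 1)) where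
  length_eq := by simp
  sum_take_le t := sum_take_modify_succ L i t
  sum_drop_le t := sum_drop_modify_succ L i t
  getD_le t := by
    have h1 := getD_modify_succ L i t
    have h2 := getD_modify_succ L i (t + 1)
    omega

theorem updatedSizes_modify_pred (L : List ℕ) (i : ℕ) :
    UpdatedSizes L (L.modify i (· - 1)) where
  length_eq := by simp
  sum_take_le t := (sum_take_modify_pred L i t).trans (Nat.le_succ _)
  sum_drop_le t := (sum_drop_modify_pred L i t).trans (Nat.le_succ _)
  getD_le t := getD_pair_modify_pred L i t

theorem updatedSizes_modify_pred_succ (L : List ℕ) (i j : ℕ) :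
    UpdatedSizes L ((L.modify i (· - 1)).modify j (· + 1)) where
  length_eq := by simp
  sum_take_le t :=
    (sum_take_modify_succ _ j t).trans (Nat.add_le_add_right (sum_take_modify_pred L i t) 1)
  sum_drop_le t :=
    (sum_drop_modify_succ _ j t).trans (Nat.add_le_add_right (sum_drop_modify_pred L i t) 1)
  getD_le t := by
    have h1 := getD_modify_succ (L.modify i (· - 1)) j t
    have h2 := getD_modify_succ (L.modify i (· - 1)) j (t + 1)
    have h3 := getD_pair_modify_pred L i t
    omega

/-- The slack is `4 = 1 + 3`: one more element outside, and one fewer in the pair, which counts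
three times. Updates keep the number of intervals, so waiting times do not change. -/
theorem UpdatedSizes.forallPairs {L L' : List ℕ} (h : UpdatedSizes L L') {q q' : Bool} {T : ℕ}
    (hL : ForallPairs (StrictInv q q' T) L) :
    ForallPairs (fun a s z c r => (q = true ∧ s + 4 * waitingTime a T < 3 * z + 4) ∨
      (q' = true ∧ r + 4 * waitingTime c T < 3 * z + 4)) L' := by
  rw [forallPairs_iff_index] at hL ⊢
  intro t ht
  rw [h.length_eq] at ht ⊢
  have h1 := h.sum_take_le t
  have h2 := h.sum_drop_le (t + 2)
  have h3 := h.getD_le t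
  rcases hL t ht with ⟨hq, h4⟩ | ⟨hq, h4⟩
  · exact Or.inl ⟨hq, by omega⟩
  · exact Or.inr ⟨hq, by omega⟩

section Ordered

variable {κ : Type u} {ν : Type v} [LinearOrder κ]

theorem Gap.Update.spec {G G' : Gap κ ν} (h : G.Update G') (hG : G.WellFormed) :
    G'.WellFormed ∧ G'.queriedLeft = G.queriedLeft ∧ G'.queriedRight = G.queriedRight ∧
      UpdatedSizes (G.ivals.map Interval.size) (G'.ivals.map Interval.size) := by
  cases h with
  | insert I t e hI hk hlo hhi =>
    refine ⟨hG.insertAt hI hk hlo hhi, rfl, rfl, ?_⟩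
    rw [Gap.map_size_insertAt]
    exact updatedSizes_modify_succ _ _
  | delete j p e he =>
    refine ⟨hG.removeAt j p, rfl, rfl, ?_⟩
    rw [Gap.map_size_removeAt he]
    exact updatedSizes_modify_pred _ _
  | changeKey _ j p k h =>
    obtain ⟨hk, e, he⟩ := Gap.changeKey_eq_some h
    rw [Gap.changeKey_of_pointsTo he hk] at h
    obtain rfl := Option.some.inj h
    refine ⟨hG.insertAt_search he hk, rfl, rfl, ?_⟩
    rw [Gap.map_size_insertAt, Gap.map_size_removeAt he]
    exact updatedSizes_modify_pred_succ _ _ _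

end Ordered

section Sizes

variable {κ : Type u} {ν : Type v}

theorem Gap.map_size_mergeOuter (G : Gap κ ν) (d : ℕ) :
    (G.mergeOuter d).1.ivals.map Interval.size =
      (mergeSizes G.queriedRight G.queriedLeft d 0
        (mergeSizes G.queriedLeft G.queriedRight d 0
          (G.ivals.map Interval.size)).reverse).reverse := by
  unfold Gap.mergeOuter
  simp only [List.map_reverse]
  rw [map_size_mergePass (fun I J => by simp [Interval.union, Interval.size, add_comm]),
    List.map_reverse, map_size_mergePass (fun I J => by simp [Interval.union, Interval.size])]

theorem Gap.mergeOuter_cost_le (G : Gap κ ν) (d : ℕ) : (G.mergeOuter d).2 ≤ 4 * d := by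
  have h1 := mergePass_cost_le Interval.union G.queriedLeft G.queriedRight d 0 G.ivals
  have h2 := mergePass_cost_le (fun I J => Interval.union J I) G.queriedRight G.queriedLeft d 0
    (mergePass Interval.union G.queriedLeft G.queriedRight d 0 G.ivals).1.reverse
  simp only [Gap.mergeOuter]
  omega

theorem Gap.FullyMerged.forallPairs {G : Gap κ ν} (h : G.FullyMerged) :
    ForallPairs (fun _ s z _ r => outside G.queriedLeft G.queriedRight s r < z)
      (G.ivals.map Interval.size) := by
  rw [forallPairs_iff_index]
  intro t ht
  exact h t (by simpa using ht)

/-- If both intervals of a pair lie on one side, the minimum in `outside` is attained on that side.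
-/
theorem Gap.balancedWithin_three {G : Gap κ ν} (h : ForallPairs
    (fun _ s z _ r => outside G.queriedLeft G.queriedRight s r < 3 * z)
    (G.ivals.map Interval.size)) : G.BalancedWithin 3 := by
  rw [forallPairs_iff_index] at h
  intro t ht
  have h1 : outside G.queriedLeft G.queriedRight (G.before t) (G.after (t + 1)) <
      3 * (G.sizeAt t + G.sizeAt (t + 1)) := h t (by simpa using ht)
  have h2 := G.before_add_after t
  have h3 := G.before_add_after (t + 1)
  have h4 := G.before_mono (show t ≤ t + 1 by omega)
  have h5 := G.before_mono (show t + 1 ≤ t + 1 + 1 by omega)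
  constructor
  · rintro ⟨hq, -⟩ ⟨-, hr⟩
    have : G.before t < 3 * (G.sizeAt t + G.sizeAt (t + 1)) := by
      rw [hq] at h1
      cases hq' : G.queriedRight with
      | false => simpa [hq', outside] using h1
      | true =>
        have := hr hq'
        simp only [hq', outside] at h1
        omega
    exact_mod_cast this
  · rintro ⟨hq, hr⟩ -
    have : G.after (t + 1) < 3 * (G.sizeAt t + G.sizeAt (t + 1)) := by
      rw [hq] at h1
      cases hq' : G.queriedLeft with
      | false => simpa [hq', outside] using h1
      | true =>
        have := hr hq'
        simp only [hq', outside] at h1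
        omega
    exact_mod_cast this

end Sizes

section Ordered

variable {κ : Type u} {ν : Type v} [LinearOrder κ]

/-- A round costs at most `4 * 18 * (padicValNat 2 T + 1)`, and the valuations add up to that of the
factorial. Without a queried end there is no invariant, and balance is vacuous. -/
theorem StrictRun.spec {T m : ℕ} {G : Gap κ ν} (h : StrictRun 18 T m G) :
    G.WellFormed ∧
      (G.queriedLeft = true ∨ G.queriedRight = true →
        ForallPairs (StrictInv G.queriedLeft G.queriedRight T) (G.ivals.map Interval.size)) ∧
      m ≤ 72 * (T + padicValNat 2 T.factorial) := by
  induction h with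
  | start G hG hm =>
    exact ⟨hG, fun hq => forallPairs_strictInv hq (hm.forallPairs.imp fun _ _ _ _ _ => Or.inl),
      by simp⟩
  | step T m G G' hrun hup ih =>
    obtain ⟨hG, hinv, hm⟩ := ih
    obtain ⟨hG', hql, hqr, hsz⟩ := hup.spec hG
    refine ⟨hG'.mergeOuter _, fun hq => ?_, ?_⟩
    · rw [Gap.map_size_mergeOuter]
      have hq' : G'.queriedLeft = true ∨ G'.queriedRight = true := hq
      refine forallPairs_round hq' ?_
      rw [hql, hqr] at hq' ⊢
      exact hsz.forallPairs (hinv hq')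
    · have h1 := G'.mergeOuter_cost_le (checkDepth 18 (T + 1))
      have h2 : padicValNat 2 (T + 1).factorial =
          padicValNat 2 (T + 1) + padicValNat 2 T.factorial := by
        rw [Nat.factorial_succ, padicValNat.mul (by omega) (Nat.factorial_ne_zero T)]
      have h3 : checkDepth 18 (T + 1) = 18 * (padicValNat 2 (T + 1) + 1) := rfl
      omega

theorem StrictRun.balanced {T m : ℕ} {G : Gap κ ν} (h : StrictRun 18 T m G) :
    G.WellFormed ∧ G.BalancedWithin 3 ∧ m ≤ 144 * T := by
  obtain ⟨h1, h2, h3⟩ := h.spec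
  refine ⟨h1, ?_, ?_⟩
  · by_cases hq : G.queriedLeft = true ∨ G.queriedRight = true
    · exact Gap.balancedWithin_three ((h2 hq).imp fun _ _ _ _ _ => StrictInv.outside_lt)
    · intro t ht
      exact ⟨fun h => absurd (Or.inl h.1) hq, fun h => absurd (Or.inr h.1) hq⟩
  · have h4 := sub_one_mul_padicValNat_factorial (p := 2) T
    omega

end Ordered

/-! ### The expected time of change-key -/

/-- The bounds `b t + 1 ≤ C * (b (t + 2) - b t)` telescope with stride two. Strictness of the growth
hypothesis pays for the `+ 1` in each term, that is, for the number of intervals. -/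
theorem sum_le_of_growth {b : ℕ → ℕ} {C J : ℕ} (hb : ∀ t, t + 1 ≤ J → b t ≤ b (t + 1))
    (hg : ∀ t, t + 2 ≤ J → b t < C * (b (t + 2) - b t)) :
    ∑ t ∈ Finset.range (J + 1), (b t + 1) ≤ (2 * C + 2) * (b J + 1) := by
  have key : ∀ i, i + 1 ≤ J →
      ∑ t ∈ Finset.range (i + 2), (b t + 1) ≤ (C + 1) * (b i + b (i + 1)) + 2 := by
    intro i
    induction i with
    | zero =>
      intro _
      simp only [zero_add, Finset.sum_range_succ, Finset.sum_range_zero]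
      nlinarith [Nat.zero_le (C * (b 0 + b 1))]
    | succ i ih =>
      intro hi
      rw [Finset.sum_range_succ]
      have h1 := ih (by omega)
      have h2 := hg i (by omega)
      have h3 := hb i (by omega)
      have h4 := hb (i + 1) (by omega)
      obtain ⟨z, hz⟩ := Nat.exists_eq_add_of_le (h3.trans h4)
      have hz' : b (i + 2) = b i + z := hz
      rw [hz', Nat.add_sub_cancel_left] at h2
      have h5 : 0 < z := by
        rcases Nat.eq_zero_or_pos z with rfl | h
        · simp at h2
        · exact h
      rw [show i + 1 + 1 = i + 2 by ring, hz']
      nlinarith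
  cases J with
  | zero =>
    simp only [zero_add, Finset.sum_range_succ, Finset.sum_range_zero]
    nlinarith [Nat.zero_le (C * (b 0 + 1))]
  | succ i =>
    have h1 := key i le_rfl
    have h2 := hb i le_rfl
    have h3 : (C + 1) * b i ≤ (C + 1) * b (i + 1) := Nat.mul_le_mul_left _ h2
    nlinarith

/-- The number of `t ≤ J` with `y ≤ b t + 1`. -/
def reach (b : ℕ → ℕ) (J y : ℕ) : ℕ := ((Finset.range (J + 1)).filter fun t => y ≤ b t + 1).card

theorem le_reach {b : ℕ → ℕ} {J y d s : ℕ} (hb : ∀ t, s ≤ t → t ≤ J → b s ≤ b t)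
    (hs : J + 1 ≤ s + d) (hsd : s + d ≤ J + 1) (hy : y ≤ b s + 1) : d ≤ reach b J y := by
  have h1 : Finset.Ico s (J + 1) ⊆ (Finset.range (J + 1)).filter fun t => y ≤ b t + 1 := by
    intro t ht
    simp only [Finset.mem_Ico, Finset.mem_filter, Finset.mem_range] at ht ⊢
    exact ⟨ht.2, hy.trans (Nat.add_le_add_right (hb t ht.1 (by omega)) 1)⟩
  have h2 := Finset.card_le_card h1
  rw [Nat.card_Ico] at h2
  unfold reach
  omega

/-- Double counting: for fixed `t`, the injective positive labels `y x` that are at most `b t + 1`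
number at most `b t + 1`. -/
theorem sum_reach_le {b : ℕ → ℕ} {J : ℕ} {V : Finset ℕ} {y : ℕ → ℕ} (hy : Set.InjOn y V)
    (hpos : ∀ x ∈ V, 0 < y x) :
    ∑ x ∈ V, reach b J (y x) ≤ ∑ t ∈ Finset.range (J + 1), (b t + 1) := by
  simp only [reach, Finset.card_filter]
  rw [Finset.sum_comm]
  refine Finset.sum_le_sum fun t _ => ?_
  rw [← Finset.card_filter]
  have h : (V.filter fun x => y x ≤ b t + 1).card ≤ (Finset.Icc 1 (b t + 1)).card := by
    refine Finset.card_le_card_of_injOn y ?_ (hy.mono fun x hx => (Finset.mem_filter.1 hx).1)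
    intro x hx
    obtain ⟨h1, h2⟩ := Finset.mem_filter.1 hx
    exact Finset.mem_Icc.2 ⟨hpos x h1, h2⟩
  simpa using h

open MeasureTheory ProbabilityTheory in
/-- The expected value of a function of a uniformly random element of `V`. -/
theorem lintegral_le_of_hasLaw_uniformOn {Ω : Type*} [MeasurableSpace Ω] {P : Measure Ω}
    {V : Finset ℕ} (hV : V.Nonempty) {X : Ω → ℕ}
    (hX : HasLaw X (uniformOn (V : Set ℕ)) P) {f : Ω → ENNReal} {g : ℕ → ℕ} {K : ℕ}
    (hfg : ∀ᵐ ω ∂P, X ω ∈ V → f ω ≤ g (X ω)) (hg : ∑ x ∈ V, g x ≤ K * V.card) :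
    ∫⁻ ω, f ω ∂P ≤ K := by
  have hmem : ∀ᵐ ω ∂P, X ω ∈ V := by
    have h : ∀ᵐ x ∂(uniformOn (V : Set ℕ)), x ∈ (V : Set ℕ) :=
      ae_cond_mem (Set.to_countable _).measurableSet
    rw [← hX.map_eq] at h
    exact ae_of_ae_map hX.aemeasurable h
  calc ∫⁻ ω, f ω ∂P ≤ ∫⁻ ω, (g (X ω) : ENNReal) ∂P := by
        refine lintegral_mono_ae ?_
        filter_upwards [hfg, hmem] with ω h1 h2 using h1 h2
    _ = ∫⁻ x, (g x : ENNReal) ∂(uniformOn (V : Set ℕ)) := by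
        rw [← hX.map_eq, lintegral_map' (by fun_prop) hX.aemeasurable]
    _ = (V.card : ENNReal)⁻¹ * ∑ x ∈ V, (g x : ENNReal) := by
        rw [uniformOn, ProbabilityTheory.cond, lintegral_smul_measure, Measure.count_apply_finset,
          lintegral_finset, smul_eq_mul]
        simp
    _ ≤ (V.card : ENNReal)⁻¹ * ((K : ENNReal) * V.card) := by
        gcongr
        exact_mod_cast hg
    _ = K := by
        rw [mul_comm, mul_assoc, ENNReal.mul_inv_cancel (by simpa using hV.ne_empty)
          (ENNReal.natCast_ne_top _), mul_one]

open MeasureTheory ProbabilityTheory in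
-- Since `b J` and `1` are at most the cardinality of `V`, the mean of `reach` is at most `2 * (2 *
-- C + 2)`; then `12 + 3 * (4 * C + 4) = 24 + 12 * C`. The labels `y` allow ranks to be counted from
-- either end.
theorem lintegral_le_of_reach {Ω : Type*} [MeasurableSpace Ω] {P : Measure Ω}
    {V : Finset ℕ} (hV : V.Nonempty) {X : Ω → ℕ}
    (hX : HasLaw X (uniformOn (V : Set ℕ)) P) {f : Ω → ENNReal} {b : ℕ → ℕ} {J C : ℕ}
    {y : ℕ → ℕ} (hy : Set.InjOn y V) (hpos : ∀ x ∈ V, 0 < y x) (hbV : b J ≤ V.card)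
    (hb : ∀ t, t + 1 ≤ J → b t ≤ b (t + 1))
    (hg : ∀ t, t + 2 ≤ J → b t < C * (b (t + 2) - b t))
    (hf : ∀ᵐ ω ∂P, X ω ∈ V → f ω ≤ (12 + 3 * reach b J (y (X ω)) : ℕ)) :
    ∫⁻ ω, f ω ∂P ≤ (24 + 12 * C : ℕ) := by
  refine lintegral_le_of_hasLaw_uniformOn hV hX (g := fun x => 12 + 3 * reach b J (y x)) hf ?_
  have h1 := sum_reach_le (b := b) (J := J) hy hpos
  have h2 := sum_le_of_growth hb hg
  have h3 : 1 ≤ V.card := hV.card_pos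
  have h4 : (2 * C + 2) * (b J + 1) ≤ (2 * C + 2) * (V.card + V.card) :=
    Nat.mul_le_mul_left _ (by omega)
  rw [Finset.sum_add_distrib, ← Finset.mul_sum, Finset.sum_const, smul_eq_mul]
  nlinarith

/-! ### Ranks and positions in the array -/

section Sizes

variable {κ : Type u} {ν : Type v}

theorem Gap.elems_eq_take_append_drop (G : Gap κ ν) (i : ℕ) :
    G.elems = (G.ivals.take i).flatMap Interval.elems ++
      (G.ivals.drop i).flatMap Interval.elems := by
  rw [← List.flatMap_append, List.take_append_drop]
  rfl

theorem Gap.length_take_elems (G : Gap κ ν) (i : ℕ) :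
    ((G.ivals.take i).flatMap Interval.elems).length = G.before i := by
  rw [List.length_flatMap, Gap.before, ← List.map_take]
  rfl

theorem sum_take_modify_pred_ge (L : List ℕ) (i t : ℕ) :
    (L.take t).sum ≤ ((L.modify i (· - 1)).take t).sum + 1 := by
  induction L generalizing i t with
  | nil => simp
  | cons x L ih =>
    cases t with
    | zero => simp
    | succ t =>
      cases i with
      | zero => simp; omega
      | succ i => have := ih i t; simp; omega

theorem Gap.before_removeAt_le {G : Gap κ ν} {j p : ℕ} {e : κ × ν} (he : G.PointsTo j p e)
    (t : ℕ) : (G.removeAt j p).before t ≤ G.before t := by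
  unfold Gap.before
  rw [Gap.map_size_removeAt he]
  exact sum_take_modify_pred _ _ _

theorem Gap.before_le_removeAt {G : Gap κ ν} {j p : ℕ} {e : κ × ν} (he : G.PointsTo j p e)
    (t : ℕ) : G.before t ≤ (G.removeAt j p).before t + 1 := by
  unfold Gap.before
  rw [Gap.map_size_removeAt he]
  exact sum_take_modify_pred_ge _ _ _

end Sizes

section Ordered

variable {κ : Type u} {ν : Type v} [LinearOrder κ]

/-- If all of interval `i` lies to the right of `k`, then the elements that are at most `k` are left
of interval `i`. -/
theorem Gap.WellFormed.countP_le {G : Gap κ ν} (hG : G.WellFormed) {k : κ} {i : ℕ}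
    (h : G.loLE k i = false) : G.elems.countP (fun x => decide (x.1 ≤ k)) ≤ G.before i := by
  have hall : ∀ d, i + d < G.ivals.length → G.loLE k (i + d) = false := by
    intro d
    induction d with
    | zero => exact fun _ => h
    | succ d ih =>
      intro hd
      by_contra h1
      have := hG.loLE_pred (k := k) (i := i + d) hd (Bool.eq_true_of_not_eq_false h1)
      rw [ih (by omega)] at this
      cases this
  rw [G.elems_eq_take_append_drop i, List.countP_append, ← G.length_take_elems i]
  have h0 : ((G.ivals.drop i).flatMap Interval.elems).countP (fun x => decide (x.1 ≤ k)) = 0 := by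
    rw [List.countP_eq_zero]
    intro e he
    obtain ⟨I, hI, he⟩ := List.mem_flatMap.1 he
    obtain ⟨d, hd⟩ := List.mem_iff_getElem?.1 hI
    rw [List.getElem?_drop] at hd
    have h1 := hall d (List.getElem?_eq_some_iff.1 hd).1
    simp only [Gap.loLE, hd, decide_eq_false_iff_not, not_le] at h1
    have h2 := (hG.mem I (List.mem_of_mem_drop hI) e he).1
    simpa using WithBot.coe_lt_coe.1 (h1.trans_le h2)
  rw [h0, add_zero]
  exact List.countP_le_length

/-- If all of interval `i` lies to the left of `k`, then all elements up to interval `i` are smaller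
than `k`. -/
theorem Gap.WellFormed.le_countP {G : Gap κ ν} (hG : G.WellFormed) {k : κ} {i : ℕ}
    (h : G.leHi k i = false) :
    G.before (i + 1) ≤ G.elems.countP (fun x => decide (x.1 < k)) := by
  have hi : i < G.ivals.length := by
    by_contra hi
    simp [Gap.leHi, List.getElem?_eq_none (not_lt.1 hi)] at h
  have hall : ∀ d, d ≤ i → G.leHi k (i - d) = false := by
    intro d
    induction d with
    | zero => exact fun _ => h
    | succ d ih =>
      intro hd
      by_contra h1
      have h2 := hG.leHi_succ (k := k) (i := i - (d + 1)) (by omega) (by simpa using h1)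
      rw [show i - (d + 1) + 1 = i - d by omega, ih (by omega)] at h2
      cases h2
  rw [G.elems_eq_take_append_drop (i + 1), List.countP_append, ← G.length_take_elems (i + 1)]
  have h0 : ((G.ivals.take (i + 1)).flatMap Interval.elems).countP (fun x => decide (x.1 < k)) =
      ((G.ivals.take (i + 1)).flatMap Interval.elems).length := by
    rw [List.countP_eq_length]
    intro e he
    obtain ⟨I, hI, he⟩ := List.mem_flatMap.1 he
    obtain ⟨d, hd⟩ := List.mem_iff_getElem?.1 hI
    rw [List.getElem?_take] at hd
    split_ifs at hd with hdi
    have h1 := hall (i - d) (by omega)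
    rw [show i - (i - d) = d by omega] at h1
    simp only [Gap.leHi, hd, decide_eq_false_iff_not, not_le] at h1
    have h2 := (hG.mem I (List.mem_of_mem_take hI) e he).2
    simpa using WithTop.coe_lt_coe.1 (h2.trans_lt h1)
  omega

theorem Gap.loLE_removeAt (G : Gap κ ν) (j p t : ℕ) (k : κ) :
    (G.removeAt j p).loLE k t = G.loLE k t := by
  simp only [Gap.loLE, Gap.removeAt, List.getElem?_modify]
  cases G.ivals[t]? with
  | none => rfl
  | some I => by_cases h : j = t <;> simp [h]

theorem Gap.leHi_removeAt (G : Gap κ ν) (j p t : ℕ) (k : κ) :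
    (G.removeAt j p).leHi k t = G.leHi k t := by
  simp only [Gap.leHi, Gap.removeAt, List.getElem?_modify]
  cases G.ivals[t]? with
  | none => rfl
  | some I => by_cases h : j = t <;> simp [h]

/-- The new rank bounds the interval found by the search. -/
theorem Gap.WellFormed.search_rank {G : Gap κ ν} (hG : G.WellFormed) {j p : ℕ} {e : κ × ν}
    (he : G.PointsTo j p e) {k : κ} {x : ℕ} (hx : G.IsNewRank j p k x) :
    ((G.search j k).1 < j → x ≤ G.before ((G.search j k).1 + 1) + 1) ∧
      (j < (G.search j k).1 → G.before (G.search j k).1 ≤ x) := by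
  obtain ⟨-, -, -, h1, h2, -⟩ := hG.search_spec he.lt_length k
  obtain ⟨hx1, hx2⟩ := hx
  generalize (G.search j k).1 = t at *
  constructor
  · intro ht
    have h3 := (hG.removeAt j p).countP_le (k := k) (i := t + 1)
      (by rw [Gap.loLE_removeAt]; exact h1 ht)
    have h4 := Gap.before_removeAt_le he (t + 1)
    omega
  · intro ht
    have h3 := (hG.removeAt j p).le_countP (k := k) (i := t - 1)
      (by rw [Gap.leHi_removeAt]; exact h2 ht)
    rw [show t - 1 + 1 = t by omega] at h3
    have h4 := Gap.before_le_removeAt he t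
    omega

theorem Gap.IsRank.bounds {G : Gap κ ν} {j p r : ℕ} (h : G.IsRank j p r) :
    G.before j < r ∧ r ≤ G.before (j + 1) := by
  obtain ⟨I, e, hI, -, h1, h2⟩ := h
  refine ⟨by omega, h2.trans ?_⟩
  have h3 : G.sizeAt j = I.elems.length := by
    simp [Gap.sizeAt, List.getD_eq_getElem?_getD, hI, Interval.size]
  rw [G.before_succ, h3]
  exact Nat.add_le_add_left List.countP_le_length _

end Ordered

/-! ### Consequences of balance -/

section Sizes

variable {κ : Type u} {ν : Type v}

theorem Gap.BalancedWithin.nat {c : ℝ} {G : Gap κ ν} (h : G.BalancedWithin c) {t : ℕ}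
    (ht : t + 1 < G.ivals.length) :
    (G.OnLeft t → G.OnLeft (t + 1) →
      G.before t < ⌈c⌉₊ * (G.before (t + 2) - G.before t)) ∧
    (G.OnRight t → G.OnRight (t + 1) →
      G.after (t + 1) < ⌈c⌉₊ * (G.before (t + 2) - G.before t)) := by
  have h0 : G.before (t + 2) - G.before t = G.sizeAt t + G.sizeAt (t + 1) := by
    rw [show t + 2 = t + 1 + 1 from rfl, G.before_succ (t + 1), G.before_succ t]
    omega
  have h1 : c * ((G.sizeAt t : ℝ) + (G.sizeAt (t + 1) : ℝ)) ≤
      ((⌈c⌉₊ * (G.sizeAt t + G.sizeAt (t + 1)) : ℕ) : ℝ) := by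
    push_cast
    exact mul_le_mul_of_nonneg_right (Nat.le_ceil c) (by positivity)
  rw [h0]
  constructor
  · intro h2 h3
    exact_mod_cast ((h t ht).1 h2 h3).trans_le h1
  · intro h2 h3
    exact_mod_cast ((h t ht).2 h2 h3).trans_le h1

/-- Two adjacent empty intervals would have the same number of elements on either side, hence lie on
the same side, where balance would require a natural number below 0. -/
theorem Gap.BalancedWithin.before_lt {c : ℝ} {G : Gap κ ν} (h : G.BalancedWithin c)
    (hq : G.queriedLeft = true ∨ G.queriedRight = true) {t : ℕ}
    (ht : t + 1 < G.ivals.length) : G.before t < G.before (t + 2) := by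
  by_contra hlt
  have h1 := G.before_mono (show t ≤ t + 1 by omega)
  have h2 := G.before_mono (show t + 1 ≤ t + 2 by omega)
  have h3 := G.before_add_after t
  have h4 := G.before_add_after (t + 1)
  rw [show t + 1 + 1 = t + 2 from rfl] at h4
  have h5 : G.before (t + 2) - G.before t = 0 := by omega
  have h6 := h.nat ht
  rw [h5, mul_zero] at h6
  by_cases hl : G.OnLeft t
  · exact Nat.not_lt_zero _ (h6.1 hl ⟨hl.1, fun h => by have := hl.2 h; omega⟩)
  · have hr : G.OnRight t := by
      unfold Gap.OnLeft at hl
      unfold Gap.OnRight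
      cases hL : G.queriedLeft <;> cases hR : G.queriedRight <;> simp_all
    exact Nat.not_lt_zero _ (h6.2 hr ⟨hr.1, fun h => by have := hr.2 h; omega⟩)

end Sizes

section Ordered

variable {κ : Type u} {ν : Type v} [LinearOrder κ]

/-- The allowance 2 covers moves away from the closest query; `4 + 2 + 3 * (2 + R) = 12 + 3 * R`. -/
theorem Gap.WellFormed.changeKey_cost {G : Gap κ ν} (hG : G.WellFormed) {j p : ℕ} {e : κ × ν}
    (he : G.PointsTo j p e) {k : κ} (hk : G.InRange k) {R : ℕ}
    (h : (G.search j k).1 - j + (j - (G.search j k).1) ≤ 2 + R) :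
    (G.changeKey j p k).2 ≤ 12 + 3 * R := by
  obtain ⟨-, -, -, -, -, h1⟩ := hG.search_spec he.lt_length k
  rw [Gap.changeKey_of_pointsTo he hk]
  simp only
  omega

open MeasureTheory ProbabilityTheory in
theorem Gap.WellFormed.lintegral_changeKey_left {c : ℝ} {G : Gap κ ν} (hG : G.WellFormed)
    (hc : G.BalancedWithin c) {j p r : ℕ} {e : κ × ν} (he : G.PointsTo j p e)
    (hr : G.IsRank j p r) (hq : G.ClosestQuery r .left) {V : Finset ℕ} (hV : V.Nonempty)
    (hV' : V = G.closerRanks r .left ∨ V = insert r (G.closerRanks r .left))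
    {Ω : Type*} [MeasurableSpace Ω] {P : Measure Ω} {newKey : Ω → κ} {newRank : Ω → ℕ}
    (hlaw : HasLaw newRank (uniformOn (V : Set ℕ)) P)
    (hkey : ∀ᵐ ω ∂P, G.InRange (newKey ω) ∧ G.IsNewRank j p (newKey ω) (newRank ω)) :
    ∫⁻ ω, ((G.changeKey j p (newKey ω)).2 : ENNReal) ∂P ≤ (24 + 12 * ⌈c⌉₊ : ℕ) := by
  obtain ⟨hr1, hr2⟩ := hr.bounds
  have hj := he.lt_length
  have hn := G.before_add_after j
  have hVr : ∀ x ∈ V, 1 ≤ x ∧ x ≤ r := by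
    intro x hx
    rcases hV' with rfl | rfl <;> simp [Gap.closerRanks] at hx <;> omega
  have hcard : G.before j ≤ V.card := by
    have h1 : Finset.Ico 1 r ⊆ V := by
      rcases hV' with rfl | rfl
      · exact Finset.Subset.refl _
      · exact Finset.subset_insert _ _
    have h2 := Finset.card_le_card h1
    rw [Nat.card_Ico] at h2
    omega
  refine lintegral_le_of_reach hV hlaw (b := G.before) (J := j) (y := id)
    (Function.injective_id.injOn) (fun x hx => (hVr x hx).1) hcard
    (fun t _ => G.before_mono (Nat.le_succ t)) ?_ ?_
  · intro t ht
    have h1 := G.before_mono ht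
    have h2 := G.before_mono (show t + 1 ≤ t + 2 by omega)
    have h3 := G.before_mono (show t ≤ t + 1 by omega)
    have h4 := G.before_add_after t
    have h5 := G.before_add_after (t + 1)
    rw [show t + 1 + 1 = t + 2 from rfl] at h5
    exact (hc.nat (by omega)).1 ⟨hq.1, fun h => by have := hq.2 h; omega⟩
      ⟨hq.1, fun h => by have := hq.2 h; omega⟩
  · filter_upwards [hkey] with ω hω hmem
    obtain ⟨h1, h2⟩ := hG.search_rank he hω.2
    obtain ⟨h3, -⟩ := hG.search_spec hj (newKey ω)
    have hx := hVr _ hmem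
    refine Nat.cast_le.2 (hG.changeKey_cost he hω.1 ?_)
    generalize (G.search j (newKey ω)).1 = t at *
    rcases lt_trichotomy t j with ht | rfl | ht
    · have := le_reach (b := G.before) (J := j) (s := t + 1) (d := j - t)
        (fun s hs _ => G.before_mono hs) (by omega) (by omega) (h1 ht)
      simp only [id]
      omega
    · omega
    · have h4 := h2 ht
      -- The new rank is at most `r`, so no element separates interval `j` from interval `t`; three
      -- or more intervals to the right would include two adjacent empty ones.
      by_contra h5
      have h6 := hc.before_lt (Or.inl hq.1) (t := j + 1) (by omega)
      have h7 := G.before_mono (show j + 1 + 2 ≤ t by omega)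
      omega

open MeasureTheory ProbabilityTheory in
-- The mirror image: intervals are indexed from the right end by `s ↦ l - 1 - s`, prefix counts
-- become `after`, and rank `x` becomes `G.size + 1 - x`.
theorem Gap.WellFormed.lintegral_changeKey_right {c : ℝ} {G : Gap κ ν} (hG : G.WellFormed)
    (hc : G.BalancedWithin c) {j p r : ℕ} {e : κ × ν} (he : G.PointsTo j p e)
    (hr : G.IsRank j p r) (hq : G.ClosestQuery r .right) {V : Finset ℕ} (hV : V.Nonempty)
    (hV' : V = G.closerRanks r .right ∨ V = insert r (G.closerRanks r .right))
    {Ω : Type*} [MeasurableSpace Ω] {P : Measure Ω} {newKey : Ω → κ} {newRank : Ω → ℕ}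
    (hlaw : HasLaw newRank (uniformOn (V : Set ℕ)) P)
    (hkey : ∀ᵐ ω ∂P, G.InRange (newKey ω) ∧ G.IsNewRank j p (newKey ω) (newRank ω)) :
    ∫⁻ ω, ((G.changeKey j p (newKey ω)).2 : ENNReal) ∂P ≤ (24 + 12 * ⌈c⌉₊ : ℕ) := by
  obtain ⟨hr1, hr2⟩ := hr.bounds
  have hj := he.lt_length
  have hn := G.before_add_after j
  set l := G.ivals.length with hl
  have hanti : ∀ s t, s ≤ t → G.after t ≤ G.after s := fun s t hst => by
    have h1 := G.before_mono (Nat.succ_le_succ hst)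
    have h2 := G.before_add_after s
    have h3 := G.before_add_after t
    simp only [Nat.succ_eq_add_one] at h1
    omega
  have hVr : ∀ x ∈ V, r ≤ x ∧ x ≤ G.size := by
    intro x hx
    rcases hV' with rfl | rfl <;> simp [Gap.closerRanks] at hx <;> omega
  have hcard : G.after (l - 1 - (l - 1 - j)) ≤ V.card := by
    have h1 : Finset.Ioc r G.size ⊆ V := by
      rcases hV' with rfl | rfl
      · exact Finset.Subset.refl _
      · exact Finset.subset_insert _ _
    have h2 := Finset.card_le_card h1
    rw [Nat.card_Ioc] at h2
    rw [show l - 1 - (l - 1 - j) = j by omega]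
    omega
  refine lintegral_le_of_reach hV hlaw (b := fun s => G.after (l - 1 - s)) (J := l - 1 - j)
    (y := fun x => G.size + 1 - x) ?_ (fun x hx => by have := (hVr x hx).2; omega) hcard
    (fun t _ => hanti _ _ (by omega)) ?_ ?_
  · intro x hx x' hx' h
    have h1 := hVr x hx
    have h2 := hVr x' hx'
    simp only at h
    omega
  · intro s hs
    obtain ⟨t, ht⟩ : ∃ t, l - 1 - (s + 2) = t := ⟨_, rfl⟩
    have e1 : l - 1 - s = t + 1 + 1 := by omega
    simp only [ht, e1]
    have h1 := G.before_add_after t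
    have h2 := G.before_add_after (t + 1)
    have h3 := G.before_add_after (t + 1 + 1)
    have h5 := G.before_mono (show t + 1 ≤ t + 1 + 1 by omega)
    have h6 := G.before_mono (show t + 1 + 1 ≤ t + 1 + 1 + 1 by omega)
    have h7 := G.before_mono (show j + 1 ≤ t + 1 by omega)
    have h8 := (hc.nat (t := t + 1) (by omega)).2
      ⟨hq.1, fun h => by have := hq.2 h; omega⟩ ⟨hq.1, fun h => by have := hq.2 h; omega⟩
    have h9 : G.after t - G.after (t + 1 + 1) = G.before (t + 1 + 2) - G.before (t + 1) := by
      rw [show t + 1 + 2 = t + 1 + 1 + 1 from rfl]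
      omega
    rw [h9]
    exact h8
  · filter_upwards [hkey] with ω hω hmem
    obtain ⟨h1, h2⟩ := hG.search_rank he hω.2
    obtain ⟨h3, -⟩ := hG.search_spec hj (newKey ω)
    have hx := hVr _ hmem
    refine Nat.cast_le.2 (hG.changeKey_cost he hω.1 ?_)
    generalize (G.search j (newKey ω)).1 = t at *
    rcases lt_trichotomy t j with ht | rfl | ht
    · have h4 := h1 ht
      by_contra h5
      have h6 := hc.before_lt (Or.inr hq.1) (t := t + 1) (by omega)
      have h7 := G.before_mono (show t + 1 + 2 ≤ j by omega)
      omega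
    · omega
    · have h4 := h2 ht
      have h5 := G.before_add_after (t - 1)
      rw [show t - 1 + 1 = t by omega] at h5
      -- The elements before interval `t` are at most `newRank ω`, so the reflected rank is at most
      -- `G.after (t - 1) + 1`; reflected, interval `t - 1` has index `l - t`.
      have := le_reach (b := fun s => G.after (l - 1 - s)) (J := l - 1 - j) (s := l - t)
        (d := t - j) (y := G.size + 1 - newRank ω)
        (fun s hs _ => hanti _ _ (by omega)) (by omega) (by omega)
        (by
          rw [show l - 1 - (l - t) = t - 1 by omega]
          omega)
      omega

end Ordered

end LazySearch

open LazySearch MeasureTheory ProbabilityTheory in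
theorem mainTheorem6 :
    -- strict merging keeps the gap balanced within a constant factor, in amortized constant time
    (∃ (b : ℕ) (c : ℝ) (K : ℕ),
      ∀ (κ : Type*) [LinearOrder κ] (ν : Type*) (T m : ℕ) (G : Gap κ ν), StrictRun b T m G →
        G.WellFormed ∧ G.BalancedWithin c ∧ m ≤ K * T) ∧
    -- the change-key operation in a gap that is balanced within a constant factor
    (∀ c : ℝ, ∃ K : ℕ,
      ∀ (κ : Type*) [LinearOrder κ] (ν : Type*) (G : Gap κ ν), G.WellFormed → G.BalancedWithin c →
      ∀ (j p : ℕ) (e : κ × ν), G.PointsTo j p e →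
        -- it is correct for every new key in the gap
        (∀ k : κ, G.InRange k → ∃ G' : Gap κ ν, (G.changeKey j p k).1 = some G' ∧
          G'.WellFormed ∧ (e :: G'.elems).Perm ((k, e.2) :: G.elems)) ∧
        -- it takes expected constant time for a uniformly random rank closer to the closest query
        (∀ (r : ℕ) (side : Side), G.IsRank j p r → G.ClosestQuery r side →
          ∀ V : Finset ℕ, V.Nonempty →
            (V = G.closerRanks r side ∨ V = insert r (G.closerRanks r side)) →
          ∀ (Ω : Type*) [MeasurableSpace Ω] (P : Measure Ω) [IsProbabilityMeasure P]
            (newKey : Ω → κ) (newRank : Ω → ℕ),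
            HasLaw newRank (uniformOn (V : Set ℕ)) P →
            (∀ᵐ ω ∂P, G.InRange (newKey ω) ∧ G.IsNewRank j p (newKey ω) (newRank ω)) →
            ∫⁻ ω, ((G.changeKey j p (newKey ω)).2 : ENNReal) ∂P ≤ (K : ENNReal))) := by
  refine ⟨⟨18, 3, 144, fun κ _ ν T m G h => h.balanced⟩, fun c => ⟨24 + 12 * ⌈c⌉₊, ?_⟩⟩
  intro κ _ ν G hG hc j p e he
  refine ⟨fun k hk => hG.changeKey_correct he hk, ?_⟩
  intro r side hr hq V hV hV' Ω _ P _ newKey newRank hlaw hkey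
  cases side with
  | left => exact hG.lintegral_changeKey_left hc he hr hq hV hV' hlaw hkey
  | right => exact hG.lintegral_changeKey_right hc he hr hq hV hV' hlaw hkey
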